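/- Let $d\ge 1$, $c\ge 1$, $k=d+c$, and let $\Gamma\subset\mathbb R^k$ be a compact connected smooth embedded submanifold without boundary, of dimension $d$ and codimension $c$. Write $\rho(x)=\operatorname{dist}(x,\Gamma)$ and $U_\delta(\Gamma)=\{x:\rho(x)<\delta\}$, and let $\delta_0>0$ be such that every $x\in U_{\delta_0}(\Gamma)$ has a unique closest point $p(x)\in\Gamma$. Let $P_\Gamma(q)$ denote the orthogonal projection of $\mathbb R^k$ onto $T_q\Gamma$. Fix constants $\sigma,C_\rho,C_P>0$. Then there are $h_0>0$ and $C>0$, depending only on $\Gamma,\delta_0,\sigma,C_\rho,C_P$, such that the following holds for every $0<h\le h_0$. Let $\widetilde{\mathcal T}_h$ be a finite conforming mesh of closed $k$-simplices of some bounded open set $\Omega\supset U_{\delta_0}(\Gamma)$ (the union of the simplices is $\overline\Omega$), shape regular and quasi-uniform with mesh parameter $h$: each simplex has diameter at most $\sigma h$ and contains a ball of radius $h/\sigma$. Let $\mathcal K_h$ be a finite conforming mesh without boundary of nondegenerate (not necessarily shape regular) $d$-simplices in $\mathbb R^k$ with union $\Gamma_h$, such that $\Gamma_h\subset U_{\delta_0}(\Gamma)$,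 the map $p:\Gamma_h\to\Gamma$ is a bijection, $\rho\le C_\rho h^2$ on $\Gamma_h$, and $\|P_\Gamma(p(x))-P_K\|\le C_P h$ for all $K\in\mathcal K_h$, $x\in K$, where $P_K$ is the orthogonal projection onto the $d$-dimensional linear space parallel to $K$. Let $\mathcal T_h=\{T\in\widetilde{\mathcal T}_h: T\cap\Gamma_h\ne\emptyset\}$ be the active mesh, $N_h=\bigcup_{T\in\mathcal T_h}T$, and assume that $\mathcal K_h$ is compatible with it: $K\subset T$ whenever the relative interior of $K\in\mathcal K_h$ meets $T\in\mathcal T_h$. Let $V_h$ be the space of continuous functions on $N_h$ that are affine on every $T\in\mathcal T_h$, let $\nabla v$ be the elementwise gradient, let $\nabla_{\Gamma_h}v$ be the tangential gradient, equal on $K\in\mathcal K_h$, $K\subset T\in\mathcal T_h$, to $P_K\nabla(v|_T)$, and let $$\lambda_{\Gamma_h}(v)=\frac1{|\Gamma_h|}\int_{\Gamma_h}v$$ be the average of $v$ over $\Gamma_h$. Then for all $v\in V_h$ $$h^{-c}\,\|v-\lambda_{\Gamma_h}(v)\|^2_{\mathcal T_h}\;\le\; C\Bigl(\|\nabla_{\Gamma_h}v\|^2_{\Gamma_h}+h^{2-c}\,\|\nabla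 v\|^2_{\mathcal T_h}\Bigr),$$ where $\|w\|^2_{\mathcal T_h}=\sum_{T\in\mathcal T_h}\int_T|w|^2\,dx$ and $\|w\|^2_{\Gamma_h}=\sum_{K\in\mathcal K_h}\int_K|w|^2$ with respect to the $d$-dimensional surface measure. -/

import Mathlib

open scoped MeasureTheory ContDiff

noncomputable section

namespace CutFEM

/-! ### The continuous manifold -/

/-- `Γ ⊆ ℝᵏ` is a smooth embedded submanifold without boundary, of dimension `d` and
codimension `c`: around each of its points there is a smooth diffeomorphism between open sets
of `ℝᵏ` and `ℝᵈ × ℝᶜ` which maps `Γ` onto the slice `ℝᵈ × {0}`. -/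
def IsSmoothSubmanifold {k : ℕ} (d c : ℕ) (Γ : Set (EuclideanSpace ℝ (Fin k))) : Prop :=
  ∀ p ∈ Γ, ∃ φ : OpenPartialHomeomorph (EuclideanSpace ℝ (Fin k))
      (EuclideanSpace ℝ (Fin d) × EuclideanSpace ℝ (Fin c)),
    p ∈ φ.source ∧ ContDiffOn ℝ ∞ φ φ.source ∧ ContDiffOn ℝ ∞ φ.symm φ.target ∧
      ∀ x ∈ φ.source, x ∈ Γ ↔ (φ x).2 = 0

/-- The tangent space of `Γ` at `p`, spanned by the velocities at `p` of curves in `Γ`. -/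
def tangentSpace {k : ℕ} (Γ : Set (EuclideanSpace ℝ (Fin k))) (p : EuclideanSpace ℝ (Fin k)) :
    Submodule ℝ (EuclideanSpace ℝ (Fin k)) :=
  Submodule.span ℝ {w | ∃ γ : ℝ → EuclideanSpace ℝ (Fin k),
    γ 0 = p ∧ (∀ t, γ t ∈ Γ) ∧ HasDerivAt γ w 0}

/-- `q` is a point of `Γ` closest to `x`. -/
def IsClosestPoint {k : ℕ} (Γ : Set (EuclideanSpace ℝ (Fin k)))
    (x q : EuclideanSpace ℝ (Fin k)) : Prop :=
  q ∈ Γ ∧ dist x q = Metric.infDist x Γ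

/-- Every point of the tubular neighbourhood `U_δ(Γ) = {x | dist(x, Γ) < δ}` has a unique closest
point on `Γ`. -/
def HasUniqueClosestPoints {k : ℕ} (Γ : Set (EuclideanSpace ℝ (Fin k))) (δ : ℝ) : Prop :=
  ∀ x ∈ Metric.thickening δ Γ, ∃! q, IsClosestPoint Γ x q

/-- The closest point projection onto `Γ` (only used at points with a unique closest point). -/
def closestPoint {k : ℕ} (Γ : Set (EuclideanSpace ℝ (Fin k))) (x : EuclideanSpace ℝ (Fin k)) :
    EuclideanSpace ℝ (Fin k) :=
  Classical.epsilon (IsClosestPoint Γ x)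

/-! ### Simplicial meshes -/

/-- The closed simplex with the given vertices. -/
def simplex {k : ℕ} (s : Finset (EuclideanSpace ℝ (Fin k))) : Set (EuclideanSpace ℝ (Fin k)) :=
  convexHull ℝ (s : Set (EuclideanSpace ℝ (Fin k)))

/-- A finite conforming mesh of nondegenerate `m`-dimensional simplices in `ℝᵏ`; a cell is given
by its set of vertices. -/
structure Mesh (m k : ℕ) where
  cells : Finset (Finset (EuclideanSpace ℝ (Fin k)))
  card_cell : ∀ s ∈ cells, s.card = m + 1
  nondegenerate : ∀ s ∈ cells, AffineIndependent ℝ ((↑) : s → EuclideanSpace ℝ (Fin k))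
  conforming : ∀ s ∈ cells, ∀ t ∈ cells,
    simplex s ∩ simplex t =
      convexHull ℝ ((s : Set (EuclideanSpace ℝ (Fin k))) ∩ (t : Set (EuclideanSpace ℝ (Fin k))))

/-- The set covered by a mesh. -/
def Mesh.carrier {m k : ℕ} (M : Mesh m k) : Set (EuclideanSpace ℝ (Fin k)) :=
  ⋃ s ∈ M.cells, simplex s

/-- Every face of codimension one of a cell belongs to exactly two cells. -/
def Mesh.WithoutBoundary {m k : ℕ} (M : Mesh m k) : Prop :=
  ∀ s ∈ M.cells, ∀ F ⊆ s, F.card = m → {t | t ∈ M.cells ∧ F ⊆ t}.ncard = 2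

/-- Shape regularity and quasi-uniformity with mesh parameter `h` and constant `σ`: the diameter
of each cell is at most `σ h`, and each cell contains a ball of radius `h / σ`. -/
def Mesh.QuasiUniform {k : ℕ} (M : Mesh k k) (h σ : ℝ) : Prop :=
  ∀ s ∈ M.cells, Metric.diam (simplex s) ≤ σ * h ∧
    ∃ z, Metric.closedBall z (h / σ) ⊆ simplex s

/-- `𝒯` is an admissible background mesh with mesh parameter `h`: a quasi-uniform mesh of a
bounded open set `Ω` that contains the tubular neighbourhood `U_δ(Γ)`. -/
structure IsBackgroundMesh {k : ℕ} (Γ : Set (EuclideanSpace ℝ (Fin k))) (δ σ h : ℝ)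
    (Ω : Set (EuclideanSpace ℝ (Fin k))) (𝒯 : Mesh k k) : Prop where
  isOpen : IsOpen Ω
  isBounded : Bornology.IsBounded Ω
  thickening_subset : Metric.thickening δ Γ ⊆ Ω
  carrier_eq : 𝒯.carrier = closure Ω
  quasiUniform : 𝒯.QuasiUniform h σ

/-- `Γ_h = 𝒦.carrier` is an admissible discrete manifold: it lies in `U_δ(Γ)`, is mapped
bijectively onto `Γ` by the closest point projection, and satisfies
`‖ρ‖_∞ ≤ Cρ h²` and `‖P_Γᵉ - P_{Γ_h}‖_∞ ≤ CP h` on `Γ_h`. -/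
structure IsDiscreteManifold {d k : ℕ} (Γ : Set (EuclideanSpace ℝ (Fin k))) (δ Cρ CP h : ℝ)
    (𝒦 : Mesh d k) : Prop where
  withoutBoundary : 𝒦.WithoutBoundary
  subset_thickening : 𝒦.carrier ⊆ Metric.thickening δ Γ
  bijOn : Set.BijOn (closestPoint Γ) 𝒦.carrier Γ
  infDist_le : ∀ x ∈ 𝒦.carrier, Metric.infDist x Γ ≤ Cρ * h ^ 2
  projection_le : ∀ s ∈ 𝒦.cells, ∀ x ∈ simplex s,
    ‖(tangentSpace Γ (closestPoint Γ x)).starProjection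
      - (vectorSpan ℝ (simplex s)).starProjection‖ ≤ CP * h

/-- The active mesh: the cells of `𝒯` which meet `Γ_h`. -/
def activeCells {k : ℕ} (𝒯 : Mesh k k) (Γh : Set (EuclideanSpace ℝ (Fin k))) :
    Finset (Finset (EuclideanSpace ℝ (Fin k))) :=
  open Classical in 𝒯.cells.filter fun t => (simplex t ∩ Γh).Nonempty

/-- The set `N_h` covered by the active mesh. -/
def activeDomain {k : ℕ} (𝒯 : Mesh k k) (Γh : Set (EuclideanSpace ℝ (Fin k))) :
    Set (EuclideanSpace ℝ (Fin k)) :=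
  ⋃ t ∈ activeCells 𝒯 Γh, simplex t

/-- The partition `𝒦` of `Γ_h` is compatible with the active mesh: a simplex of `𝒦` whose relative
interior meets an active cell is contained in that cell. -/
def Compatible {d k : ℕ} (𝒯 : Mesh k k) (𝒦 : Mesh d k) : Prop :=
  ∀ s ∈ 𝒦.cells, ∀ t ∈ activeCells 𝒯 𝒦.carrier,
    (intrinsicInterior ℝ (simplex s) ∩ simplex t).Nonempty → simplex s ⊆ simplex t

/-! ### Discrete functions, gradients and norms -/

/-- `v ∈ V_h`: `v` is continuous on `N_h` and affine on each active cell. Values of `v` outside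
`N_h` are irrelevant. -/
def IsDiscreteFunction {k : ℕ} (𝒯 : Mesh k k) (Γh : Set (EuclideanSpace ℝ (Fin k)))
    (v : EuclideanSpace ℝ (Fin k) → ℝ) : Prop :=
  ContinuousOn v (activeDomain 𝒯 Γh) ∧
    ∀ t ∈ activeCells 𝒯 Γh, ∃ A : EuclideanSpace ℝ (Fin k) →ᵃ[ℝ] ℝ, Set.EqOn v A (simplex t)

/-- The tangential gradient of `v` along a simplex `S` at `x ∈ S`: the gradient, in the linear
space parallel to `S`, of the restriction of `v` to `S`. It is the orthogonal projection onto that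
space of the full gradient of any differentiable extension of `v` from `S`. -/
def tangentialGradient {k : ℕ} (v : EuclideanSpace ℝ (Fin k) → ℝ)
    (S : Set (EuclideanSpace ℝ (Fin k))) (x : EuclideanSpace ℝ (Fin k)) : vectorSpan ℝ S :=
  gradientWithin (fun w : vectorSpan ℝ S => v (x + w)) {w | x + (w : EuclideanSpace ℝ (Fin k)) ∈ S} 0

/-- The average `λ_{Γ_h}(v)` of `v` over `Γ_h`, with respect to the `d`-dimensional surface
measure. -/
def surfaceMean {d k : ℕ} (𝒦 : Mesh d k) (v : EuclideanSpace ℝ (Fin k) → ℝ) : ℝ :=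
  ⨍ x in 𝒦.carrier, v x ∂μHE[d]

/-- `‖w‖²_{𝒯_h}`, the squared `L²` norm over the active mesh. -/
def activeNormSq {k : ℕ} (𝒯 : Mesh k k) (Γh : Set (EuclideanSpace ℝ (Fin k)))
    (w : EuclideanSpace ℝ (Fin k) → ℝ) : ℝ :=
  ∑ t ∈ activeCells 𝒯 Γh, ∫ x in simplex t, w x ^ 2

/-- `‖∇v‖²_{𝒯_h}`, with the full gradient taken cell by cell. -/
def activeGradNormSq {k : ℕ} (𝒯 : Mesh k k) (Γh : Set (EuclideanSpace ℝ (Fin k)))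
    (v : EuclideanSpace ℝ (Fin k) → ℝ) : ℝ :=
  ∑ t ∈ activeCells 𝒯 Γh, ∫ x in simplex t, ‖gradientWithin v (simplex t) x‖ ^ 2

/-- `‖∇_{Γ_h} v‖²_{Γ_h}`. -/
def surfaceGradNormSq {d k : ℕ} (𝒦 : Mesh d k) (v : EuclideanSpace ℝ (Fin k) → ℝ) : ℝ :=
  ∑ s ∈ 𝒦.cells, ∫ x in simplex s, ‖tangentialGradient v (simplex s) x‖ ^ 2 ∂μHE[d]

end CutFEM

end

section

open scoped ENNReal NNReal Topology
open MeasureTheory Set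

noncomputable section

namespace CutFEM

/-- Intermediate value theorem, measured: if the sets `A i` cover the unit interval, then the images
of a continuous function on them have total length at least its increment. -/
theorem ofReal_abs_sub_le_sum_volume_image {ι : Type*} {f : ℝ → ℝ}
    (hf : ContinuousOn f (Icc 0 1)) (I : Finset ι) (A : ι → Set ℝ)
    (hA : Icc (0 : ℝ) 1 ⊆ ⋃ i ∈ I, A i) :
    ENNReal.ofReal |f 1 - f 0| ≤ ∑ i ∈ I, volume (f '' (A i ∩ Icc 0 1)) := by
  have h1 : uIcc (f 0) (f 1) ⊆ ⋃ i ∈ I, f '' (A i ∩ Icc 0 1) := by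
    have h2 := intermediate_value_uIcc (a := (0 : ℝ)) (b := 1) (f := f)
      (by rwa [uIcc_of_le zero_le_one])
    intro y hy
    obtain ⟨t, ht, rfl⟩ := h2 hy
    rw [uIcc_of_le zero_le_one] at ht
    obtain ⟨i, hi, hti⟩ := mem_iUnion₂.1 (hA ht)
    exact mem_iUnion₂.2 ⟨i, hi, t, ⟨hti, ht⟩, rfl⟩
  calc ENNReal.ofReal |f 1 - f 0| = volume (uIcc (f 0) (f 1)) := by
        rw [uIcc, Real.volume_Icc, max_sub_min_eq_abs']
        rw [abs_sub_comm]
    _ ≤ volume (⋃ i ∈ I, f '' (A i ∩ Icc 0 1)) := measure_mono h1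
    _ ≤ _ := measure_biUnion_finset_le _ _

theorem volume_image_le_of_lipschitzOnWith {f : ℝ → ℝ} {s : Set ℝ} {K : ℝ≥0}
    (h : LipschitzOnWith K f s) : volume (f '' s) ≤ K * volume s := by
  have := h.hausdorffMeasure_image_le (d := 1) zero_le_one
  simpa [hausdorffMeasure_real] using this

/-- A finite measurable cover can be refined to a disjoint one. -/
theorem exists_disjoint_refinement {ι α : Type*} [MeasurableSpace α] (I : Finset ι)
    (D : ι → Set α) (hD : ∀ i ∈ I, MeasurableSet (D i)) :
    ∃ D' : ι → Set α, (∀ i ∈ I, MeasurableSet (D' i)) ∧ (∀ i, D' i ⊆ D i) ∧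
      (I : Set ι).PairwiseDisjoint D' ∧ ⋃ i ∈ I, D i ⊆ ⋃ i ∈ I, D' i := by
  classical
  induction I using Finset.induction_on with
  | empty => exact ⟨D, by simp, fun _ => subset_rfl, by simp, by simp⟩
  | insert a s ha ih =>
    obtain ⟨D', h1, h2, h3, h4⟩ := ih (fun i hi => hD i (Finset.mem_insert_of_mem hi))
    have hne : ∀ i ∈ s, i ≠ a := fun i hi h => ha (h ▸ hi)
    refine ⟨Function.update D' a (D a \ ⋃ i ∈ s, D' i), ?_, ?_, ?_, ?_⟩
    · intro i hi
      rcases Finset.mem_insert.1 hi with rfl | hi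
      · rw [Function.update_self]
        exact (hD i (Finset.mem_insert_self _ _)).diff (Finset.measurableSet_biUnion _ h1)
      · rw [Function.update_of_ne (hne i hi)]
        exact h1 i hi
    · intro i
      rcases eq_or_ne i a with rfl | hi
      · rw [Function.update_self]; exact sdiff_subset
      · rw [Function.update_of_ne hi]; exact h2 i
    · rw [Finset.coe_insert, pairwiseDisjoint_insert]
      refine ⟨?_, ?_⟩
      · intro i hi j hj hij
        simp only [Function.onFun]
        rw [Function.update_of_ne (hne i hi), Function.update_of_ne (hne j hj)]
        exact h3 hi hj hij
      · intro j hj hja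
        rw [Function.update_self, Function.update_of_ne (hne j hj)]
        exact disjoint_sdiff_left.mono_right (subset_biUnion_of_mem (u := D') hj)
    · intro x hx
      by_cases hxs : x ∈ ⋃ i ∈ s, D' i
      · obtain ⟨i, hi, hxi⟩ := mem_iUnion₂.1 hxs
        refine mem_iUnion₂.2 ⟨i, Finset.mem_insert_of_mem hi, ?_⟩
        rwa [Function.update_of_ne (hne i hi)]
      · refine mem_iUnion₂.2 ⟨a, Finset.mem_insert_self _ _, ?_⟩
        rw [Function.update_self]
        refine ⟨?_, hxs⟩
        obtain ⟨i, hi, hxi⟩ := mem_iUnion₂.1 hx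
        rcases Finset.mem_insert.1 hi with rfl | hi
        · exact hxi
        · exact absurd (h4 (mem_iUnion₂.2 ⟨i, hi, hxi⟩)) hxs

section Segment

variable {F : Type*} [NormedAddCommGroup F] [NormedSpace ℝ F] [MeasurableSpace F] [BorelSpace F]

/-- The increment of a continuous, piecewise Lipschitz function along a segment is bounded by the
line integral of the local Lipschitz constant. -/
theorem ofReal_abs_sub_le_lintegral_segment {ι : Type*} {B : Set F} (hB : Convex ℝ B) {f : F → ℝ}
    (hf : ContinuousOn f B) (I : Finset ι) (D : ι → Set F) (hD : ∀ i ∈ I, MeasurableSet (D i))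
    (hcov : B ⊆ ⋃ i ∈ I, D i) (ℓ : ι → ℝ≥0)
    (hlip : ∀ i ∈ I, LipschitzOnWith (ℓ i) f (D i ∩ B)) {x y : F} (hx : x ∈ B) (hy : y ∈ B) :
    ENNReal.ofReal |f y - f x| ≤ ENNReal.ofReal ‖y - x‖ *
      ∫⁻ t in Icc (0 : ℝ) 1, ∑ i ∈ I, (D i).indicator (fun _ => (ℓ i : ℝ≥0∞))
        (AffineMap.lineMap x y t) := by
  have hline : ∀ t ∈ Icc (0 : ℝ) 1, AffineMap.lineMap x y t ∈ B := fun t ht =>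
    hB.lineMap_mem hx hy ht
  have hcont : Continuous (fun t : ℝ => (AffineMap.lineMap x y t : F)) :=
    AffineMap.lineMap_continuous
  have h1 := ofReal_abs_sub_le_sum_volume_image
    (f := fun t => f (AffineMap.lineMap x y t)) (hf.comp hcont.continuousOn hline) I
    (fun i => (fun t : ℝ => (AffineMap.lineMap x y t : F)) ⁻¹' D i) (by
      intro t ht
      simpa using hcov (hline t ht))
  simp only [AffineMap.lineMap_apply_one, AffineMap.lineMap_apply_zero] at h1
  refine h1.trans ?_
  rw [lintegral_finsetSum' _ (fun i hi => ?_), Finset.mul_sum]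
  · refine Finset.sum_le_sum fun i hi => ?_
    have hm : MeasurableSet ((fun t : ℝ => (AffineMap.lineMap x y t : F)) ⁻¹' D i) :=
      hcont.measurable (hD i hi)
    have h2 : LipschitzOnWith (ℓ i * ‖y - x‖₊) (fun t => f (AffineMap.lineMap x y t))
        ((fun t : ℝ => (AffineMap.lineMap x y t : F)) ⁻¹' D i ∩ Icc 0 1) := by
      refine LipschitzOnWith.of_dist_le_mul fun s hs t ht => ?_
      refine ((hlip i hi).dist_le_mul _ ⟨hs.1, hline s hs.2⟩ _ ⟨ht.1, hline t ht.2⟩).trans ?_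
      rw [dist_lineMap_lineMap, dist_comm x y, dist_eq_norm y x]
      push_cast
      exact le_of_eq (by ring)
    refine (volume_image_le_of_lipschitzOnWith h2).trans ?_
    have h3 : ∀ t : ℝ, (D i).indicator (fun _ => (ℓ i : ℝ≥0∞)) (AffineMap.lineMap x y t : F)
        = ((fun t : ℝ => (AffineMap.lineMap x y t : F)) ⁻¹' D i).indicator
          (fun _ => (ℓ i : ℝ≥0∞)) t := fun t => rfl
    simp_rw [h3]
    rw [lintegral_indicator_const hm, Measure.restrict_apply hm, ofReal_norm,
      enorm_eq_nnnorm]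
    push_cast
    exact le_of_eq (by ring)
  · refine Measurable.aemeasurable ?_
    exact (measurable_const.indicator (hD i hi)).comp hcont.measurable

/-- A continuous map on a convex set that is `K`-Lipschitz on each piece of a finite measurable
cover is `K`-Lipschitz. -/
theorem lipschitzOnWith_of_cover {E : Type*} [NormedAddCommGroup E] [InnerProductSpace ℝ E]
    {ι : Type*} {B : Set F} (hB : Convex ℝ B) {θ : F → E}
    (hf : ContinuousOn θ B) (I : Finset ι) (D : ι → Set F) (hD : ∀ i ∈ I, MeasurableSet (D i))
    (hcov : B ⊆ ⋃ i ∈ I, D i) (K : ℝ≥0)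
    (hlip : ∀ i ∈ I, LipschitzOnWith K θ (D i ∩ B)) : LipschitzOnWith K θ B := by
  obtain ⟨D', hm, hsub, hdisj, hcov'⟩ := exists_disjoint_refinement I D hD
  refine LipschitzOnWith.of_dist_le_mul fun y hy x hx => ?_
  set e := θ y - θ x with he
  have h1 := ofReal_abs_sub_le_lintegral_segment hB (f := fun z => inner ℝ e (θ z))
    (continuousOn_const.inner hf) I D' hm (hcov.trans hcov') (fun _ => ‖e‖₊ * K)
    (fun i hi => by
      refine LipschitzOnWith.of_dist_le_mul fun z hz w hw => ?_
      have h2 := (hlip i hi).dist_le_mul z ⟨hsub i hz.1, hz.2⟩ w ⟨hsub i hw.1, hw.2⟩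
      rw [Real.dist_eq, ← inner_sub_right]
      refine (abs_real_inner_le_norm _ _).trans ?_
      rw [dist_eq_norm] at h2
      push_cast
      rw [mul_assoc]
      gcongr) hx hy
  have h3 : ∀ z, ∑ i ∈ I, (D' i).indicator (fun _ => ((‖e‖₊ * K : ℝ≥0) : ℝ≥0∞)) z
      ≤ ((‖e‖₊ * K : ℝ≥0) : ℝ≥0∞) := by
    intro z
    by_cases hz : ∃ i ∈ I, z ∈ D' i
    · obtain ⟨i, hi, hzi⟩ := hz
      rw [Finset.sum_eq_single_of_mem i hi]
      · exact indicator_le_self _ _ _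
      · intro j hj hji
        refine indicator_of_notMem (fun hzj => ?_) _
        exact disjoint_left.1 (hdisj hj hi hji) hzj hzi
    · push Not at hz
      rw [Finset.sum_eq_zero fun i hi => indicator_of_notMem (hz i hi) _]
      exact zero_le
  have h4 := h1.trans (mul_le_mul_right (lintegral_mono fun t => h3 _) _)
  rw [lintegral_const, Measure.restrict_apply_univ, Real.volume_Icc, sub_zero,
    ENNReal.ofReal_one, mul_one] at h4
  rw [← inner_sub_right, ← he, real_inner_self_eq_norm_sq, ENNReal.ofReal_le_iff_le_toReal
    (by finiteness), ENNReal.toReal_mul, ENNReal.toReal_ofReal (norm_nonneg _)] at h4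
  simp only [ENNReal.coe_toReal, NNReal.coe_mul, coe_nnnorm, abs_pow, abs_norm] at h4
  rw [dist_eq_norm, dist_eq_norm, ← he]
  rcases (norm_nonneg e).eq_or_lt with h0 | h0
  · rw [← h0]; positivity
  · nlinarith

end Segment

theorem sq_lintegral_Icc_le {g : ℝ → ℝ≥0∞} (hg : AEMeasurable g (volume.restrict (Icc 0 1))) :
    (∫⁻ t in Icc (0 : ℝ) 1, g t) ^ 2 ≤ ∫⁻ t in Icc (0 : ℝ) 1, g t ^ 2 := by
  have h := ENNReal.lintegral_mul_le_Lp_mul_Lq (volume.restrict (Icc (0 : ℝ) 1))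
    Real.HolderConjugate.two_two hg (aemeasurable_const (b := (1 : ℝ≥0∞)))
  simp only [Pi.mul_apply, mul_one, lintegral_const, Measure.restrict_apply_univ,
    Real.volume_Icc, sub_zero, ENNReal.ofReal_one, ENNReal.rpow_ofNat, one_pow] at h
  rw [ENNReal.one_rpow, mul_one] at h
  calc _ ≤ ((∫⁻ t in Icc (0 : ℝ) 1, g t ^ 2) ^ (1 / 2 : ℝ)) ^ 2 := by gcongr
    _ = _ := by
      rw [← ENNReal.rpow_natCast, ← ENNReal.rpow_mul]
      norm_num

theorem lintegral_lintegral_symmetrize {α : Type*} [MeasurableSpace α] (μ : Measure α) [SFinite μ]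
    {Φ : α → α → ℝ≥0∞} (hΦ : Measurable (Function.uncurry Φ)) :
    ∫⁻ x, ∫⁻ y, (2 * Φ y x + 2 * Φ x y) ∂μ ∂μ = 4 * ∫⁻ x, ∫⁻ y, Φ x y ∂μ ∂μ := by
  have hs : Measurable (Function.uncurry fun x y => Φ y x) := hΦ.comp measurable_swap
  calc _ = ∫⁻ x, (2 * (∫⁻ y, Φ y x ∂μ) + 2 * ∫⁻ y, Φ x y ∂μ) ∂μ := by
        refine lintegral_congr fun x => ?_
        have h1 : Measurable fun y => Φ y x := hs.comp measurable_prodMk_left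
        have h2 : Measurable fun y => Φ x y := hΦ.comp measurable_prodMk_left
        rw [lintegral_add_left (h1.const_mul 2), lintegral_const_mul _ h1,
          lintegral_const_mul _ h2]
    _ = 2 * (∫⁻ x, ∫⁻ y, Φ y x ∂μ ∂μ) + 2 * ∫⁻ x, ∫⁻ y, Φ x y ∂μ ∂μ := by
        have h1 : Measurable fun x => ∫⁻ y, Φ y x ∂μ := hs.lintegral_prod_right'
        have h2 : Measurable fun x => ∫⁻ y, Φ x y ∂μ := hΦ.lintegral_prod_right'
        rw [lintegral_add_left (h1.const_mul 2), lintegral_const_mul _ h1,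
          lintegral_const_mul _ h2]
    _ = _ := by
        rw [lintegral_lintegral_swap (f := fun x y => Φ y x) hs.aemeasurable]
        ring

section Poincare

variable {F : Type*} [NormedAddCommGroup F] [NormedSpace ℝ F] [FiniteDimensional ℝ F]
  [MeasurableSpace F] [BorelSpace F]

theorem lintegral_comp_lineMap_le (μ : Measure F) [μ.IsAddHaarMeasure] {G : F → ℝ≥0∞}
    (hG : Measurable G) (x : F) {s : ℝ} (hs : 1 / 2 ≤ s) :
    ∫⁻ y, G (AffineMap.lineMap x y s) ∂μ ≤ 2 ^ Module.finrank ℝ F * ∫⁻ y, G y ∂μ := by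
  have hs0 : 0 < s := by linarith
  have h1 : ∫⁻ y, G (AffineMap.lineMap x y s) ∂μ = ∫⁻ y, G ((x - s • x) + s • y) ∂μ := by
    refine lintegral_congr fun y => ?_
    congr 1
    rw [AffineMap.lineMap_apply_module]
    module
  have h2 : ∫⁻ y, G ((x - s • x) + s • y) ∂μ
      = ∫⁻ z, G ((x - s • x) + z) ∂(Measure.map (s • ·) μ) := by
    exact (lintegral_map (f := fun z => G ((x - s • x) + z))
      (hG.comp (measurable_const_add _)) (measurable_const_smul s)).symm
  rw [h1, h2, Measure.map_addHaar_smul μ hs0.ne', lintegral_smul_measure,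
    lintegral_add_left_eq_self G, smul_eq_mul]
  gcongr
  rw [abs_of_pos (by positivity), ← inv_pow, ENNReal.ofReal_pow (by positivity)]
  gcongr
  rw [← ENNReal.ofReal_ofNat]
  refine ENNReal.ofReal_le_ofReal ?_
  rw [inv_le_comm₀ hs0 (by norm_num)]
  linarith

theorem measurable_comp_lineMap {G : F → ℝ≥0∞} (hG : Measurable G) :
    Measurable fun p : (F × F) × ℝ => G (AffineMap.lineMap p.1.1 p.1.2 ((1 + p.2) / 2)) := by
  refine hG.comp (Continuous.measurable ?_)
  simp_rw [AffineMap.lineMap_apply_module]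
  fun_prop

theorem measurable_lintegral_lineMap {G : F → ℝ≥0∞} (hG : Measurable G) :
    Measurable fun p : F × F =>
      ∫⁻ t in Icc (0 : ℝ) 1, G (AffineMap.lineMap p.1 p.2 ((1 + t) / 2)) :=
  (measurable_comp_lineMap hG).lintegral_prod_right'

theorem lintegral_lintegral_lineMap_le (μ : Measure F) [μ.IsAddHaarMeasure] {G : F → ℝ≥0∞}
    (hG : Measurable G) (x : F) (B : Set F) :
    ∫⁻ y in B, (∫⁻ t in Icc (0 : ℝ) 1, G (AffineMap.lineMap x y ((1 + t) / 2))) ∂μ ≤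
      2 ^ Module.finrank ℝ F * ∫⁻ z, G z ∂μ := by
  have hmx : Measurable fun p : F × ℝ => G (AffineMap.lineMap x p.1 ((1 + p.2) / 2)) :=
    (measurable_comp_lineMap hG).comp
      ((measurable_const.prodMk measurable_fst).prodMk measurable_snd)
  rw [lintegral_lintegral_swap (f := fun y t => G (AffineMap.lineMap x y ((1 + t) / 2)))
    hmx.aemeasurable]
  have h1 : ∀ t ∈ Icc (0 : ℝ) 1, ∫⁻ y in B, G (AffineMap.lineMap x y ((1 + t) / 2)) ∂μ ≤
      2 ^ Module.finrank ℝ F * ∫⁻ z, G z ∂μ := fun t ht =>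
    (setLIntegral_le_lintegral _ _).trans
      (lintegral_comp_lineMap_le μ hG x (by linarith [ht.1]))
  refine (setLIntegral_mono' measurableSet_Icc h1).trans ?_
  simp

/-- Poincaré inequality, in double integral form, on a bounded convex set, for a function whose
increments along segments are bounded by the line integrals of `g`. -/
theorem lintegral_lintegral_sq_sub_le_of_segment (μ : Measure F) [μ.IsAddHaarMeasure] {B : Set F}
    (hB : Convex ℝ B) (hBm : MeasurableSet B) {R : ℝ} (hR0 : 0 ≤ R)
    (hR : ∀ x ∈ B, ∀ y ∈ B, ‖y - x‖ ≤ R) {f : F → ℝ} {g : F → ℝ≥0∞} (hgm : Measurable g)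
    (hg : ∀ x ∈ B, ∀ y ∈ B, ENNReal.ofReal |f y - f x| ≤ ENNReal.ofReal ‖y - x‖ *
      ∫⁻ t in Icc (0 : ℝ) 1, g (AffineMap.lineMap x y t)) :
    ∫⁻ x in B, ∫⁻ y in B, ENNReal.ofReal ((f x - f y) ^ 2) ∂μ ∂μ ≤
      (4 * ENNReal.ofReal R ^ 2 * 2 ^ Module.finrank ℝ F * μ B) * ∫⁻ z, g z ^ 2 ∂μ := by
  set Φ : F → F → ℝ≥0∞ := fun x y =>
    ENNReal.ofReal (R / 2) ^ 2 * ∫⁻ t in Icc (0 : ℝ) 1, g (AffineMap.lineMap x y ((1 + t) / 2)) ^ 2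
    with hΦ
  have hΦm : Measurable (Function.uncurry Φ) :=
    (measurable_lintegral_lineMap (hgm.pow_const 2)).const_mul _
  have hhalf : ∀ x ∈ B, ∀ y ∈ B,
      ENNReal.ofReal ((f y - f (midpoint ℝ x y)) ^ 2) ≤ Φ x y := by
    intro x hx y hy
    have hmid : midpoint ℝ x y ∈ B := hB.midpoint_mem hx hy
    have h1 := hg _ hmid _ hy
    have hl : ∀ t : ℝ, (AffineMap.lineMap (midpoint ℝ x y) y t : F)
        = AffineMap.lineMap x y ((1 + t) / 2) := by
      intro t
      simp only [AffineMap.lineMap_apply_module, midpoint_eq_smul_add]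
      rw [invOf_eq_inv]
      module
    simp_rw [hl] at h1
    rw [← sq_abs, ENNReal.ofReal_pow (abs_nonneg _)]
    calc _ ≤ (ENNReal.ofReal (R / 2) *
          ∫⁻ t in Icc (0 : ℝ) 1, g (AffineMap.lineMap x y ((1 + t) / 2))) ^ 2 := by
          gcongr
          refine h1.trans ?_
          gcongr
          have : y - midpoint ℝ x y = (2⁻¹ : ℝ) • (y - x) := by
            rw [midpoint_eq_smul_add, invOf_eq_inv]
            module
          rw [this, norm_smul, Real.norm_eq_abs, abs_of_pos (by norm_num)]
          linarith [hR x hx y hy]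
      _ ≤ Φ x y := by
          rw [mul_pow]
          simp only [hΦ]
          gcongr
          refine sq_lintegral_Icc_le (Measurable.aemeasurable ?_)
          exact hgm.comp ((AffineMap.lineMap_continuous (R := ℝ) (p := x) (q := y)).measurable.comp
            (by fun_prop))
  have hpt : ∀ x ∈ B, ∀ y ∈ B, ENNReal.ofReal ((f x - f y) ^ 2) ≤ 2 * Φ y x + 2 * Φ x y := by
    intro x hx y hy
    have h1 := hhalf x hx y hy
    have h2 := hhalf y hy x hx
    rw [midpoint_comm] at h2
    refine le_trans ?_ (add_le_add (mul_le_mul_right h2 2) (mul_le_mul_right h1 2))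
    rw [← mul_add, ← ENNReal.ofReal_add (sq_nonneg _) (sq_nonneg _), ← ENNReal.ofReal_ofNat,
      ← ENNReal.ofReal_mul (by norm_num)]
    refine ENNReal.ofReal_le_ofReal ?_
    nlinarith [sq_nonneg (f x - f (midpoint ℝ x y) + (f y - f (midpoint ℝ x y)))]
  have hinner : ∀ x, ∫⁻ y in B, Φ x y ∂μ ≤
      ENNReal.ofReal (R / 2) ^ 2 * (2 ^ Module.finrank ℝ F * ∫⁻ z, g z ^ 2 ∂μ) := by
    intro x
    have hmx : Measurable fun y => ∫⁻ t in Icc (0 : ℝ) 1,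
        g (AffineMap.lineMap x y ((1 + t) / 2)) ^ 2 :=
      Measurable.of_uncurry_left (x := x) (f := fun x y => ∫⁻ t in Icc (0 : ℝ) 1,
        g (AffineMap.lineMap x y ((1 + t) / 2)) ^ 2)
        (measurable_lintegral_lineMap (hgm.pow_const 2))
    calc ∫⁻ y in B, Φ x y ∂μ = ENNReal.ofReal (R / 2) ^ 2 *
          ∫⁻ y in B, (∫⁻ t in Icc (0 : ℝ) 1, g (AffineMap.lineMap x y ((1 + t) / 2)) ^ 2) ∂μ :=
          lintegral_const_mul _ hmx
      _ ≤ _ := by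
        gcongr
        exact lintegral_lintegral_lineMap_le μ (hgm.pow_const 2) x B
  have htot : ∫⁻ x in B, ∫⁻ y in B, Φ x y ∂μ ∂μ ≤
      ENNReal.ofReal (R / 2) ^ 2 * (2 ^ Module.finrank ℝ F * ∫⁻ z, g z ^ 2 ∂μ) * μ B := by
    refine (lintegral_mono hinner).trans ?_
    simp
  calc _ ≤ ∫⁻ x in B, ∫⁻ y in B, (2 * Φ y x + 2 * Φ x y) ∂μ ∂μ :=
        setLIntegral_mono' hBm fun x hx => setLIntegral_mono' hBm fun y hy => hpt x hx y hy
    _ = 4 * ∫⁻ x in B, ∫⁻ y in B, Φ x y ∂μ ∂μ := lintegral_lintegral_symmetrize _ hΦm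
    _ ≤ 4 * (ENNReal.ofReal R ^ 2 * (2 ^ Module.finrank ℝ F *
          ∫⁻ z, g z ^ 2 ∂μ) * μ B) := by
        gcongr
        refine htot.trans ?_
        gcongr
        linarith
    _ = _ := by ring

/-- Poincaré inequality, in double integral form, for continuous piecewise Lipschitz functions on
a bounded convex set. -/
theorem lintegral_lintegral_sq_sub_le (μ : Measure F) [μ.IsAddHaarMeasure] {ι : Type*} {B : Set F}
    (hB : Convex ℝ B) (hBm : MeasurableSet B) {R : ℝ} (hR0 : 0 ≤ R)
    (hR : ∀ x ∈ B, ∀ y ∈ B, ‖y - x‖ ≤ R)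
    {f : F → ℝ} (hf : ContinuousOn f B) (I : Finset ι) (D : ι → Set F)
    (hD : ∀ i ∈ I, MeasurableSet (D i)) (hcov : B ⊆ ⋃ i ∈ I, D i)
    (ℓ : ι → ℝ≥0) (hlip : ∀ i ∈ I, LipschitzOnWith (ℓ i) f (D i)) :
    ∫⁻ x in B, ∫⁻ y in B, ENNReal.ofReal ((f x - f y) ^ 2) ∂μ ∂μ ≤
      (4 * ENNReal.ofReal R ^ 2 * 2 ^ Module.finrank ℝ F * μ B) *
        ∑ i ∈ I, (ℓ i : ℝ≥0∞) ^ 2 * μ (D i) := by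
  obtain ⟨D', hm, hsub, hdisj, hcov'⟩ := exists_disjoint_refinement I D hD
  set g : F → ℝ≥0∞ := fun z => ∑ i ∈ I, (D' i).indicator (fun _ => (ℓ i : ℝ≥0∞)) z with hg
  have hgm : Measurable g := Finset.measurable_fun_sum _ fun i hi =>
    measurable_const.indicator (hm i hi)
  have hg2 : ∀ z, g z ^ 2 = ∑ i ∈ I, (D' i).indicator (fun _ => (ℓ i : ℝ≥0∞) ^ 2) z := by
    intro z
    by_cases hz : ∃ i ∈ I, z ∈ D' i
    · obtain ⟨i, hi, hzi⟩ := hz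
      have hj : ∀ j ∈ I, j ≠ i → z ∉ D' j := fun j hj hji hzj =>
        disjoint_left.1 (hdisj hj hi hji) hzj hzi
      simp only [hg]
      rw [Finset.sum_eq_single_of_mem i hi fun j hj' hji => indicator_of_notMem (hj j hj' hji) _,
        Finset.sum_eq_single_of_mem i hi fun j hj' hji => indicator_of_notMem (hj j hj' hji) _,
        indicator_of_mem hzi, indicator_of_mem hzi]
    · push Not at hz
      simp only [hg]
      rw [Finset.sum_eq_zero fun i hi => indicator_of_notMem (hz i hi) _,
        Finset.sum_eq_zero fun i hi => indicator_of_notMem (hz i hi) _]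
      simp
  have hgint : ∫⁻ z, g z ^ 2 ∂μ ≤ ∑ i ∈ I, (ℓ i : ℝ≥0∞) ^ 2 * μ (D i) := by
    simp_rw [hg2]
    rw [lintegral_finsetSum' _ fun i hi => (measurable_const.indicator (hm i hi)).aemeasurable]
    refine Finset.sum_le_sum fun i hi => ?_
    rw [lintegral_indicator_const (hm i hi)]
    gcongr
    exact hsub i
  refine (lintegral_lintegral_sq_sub_le_of_segment μ hB hBm hR0 hR hgm fun x hx y hy => ?_).trans
    (mul_le_mul_right hgint _)
  exact ofReal_abs_sub_le_lintegral_segment hB hf I D' hm (hcov.trans hcov') ℓ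
    (fun i hi => (hlip i hi).mono (inter_subset_left.trans (hsub i))) hx hy

end Poincare

section PairEnergy

variable {α : Type*} [MeasurableSpace α]

/-- The double integral of `|f x - f y|²` over `S × S'`. -/
def pairEnergy (μ : Measure α) (f : α → ℝ) (S S' : Set α) : ℝ≥0∞ :=
  ∫⁻ x in S, ∫⁻ y in S', ENNReal.ofReal ((f x - f y) ^ 2) ∂μ ∂μ

variable {μ : Measure α} {f : α → ℝ}

theorem measurable_ofReal_sq_sub (hf : Measurable f) :
    Measurable (Function.uncurry fun x y => ENNReal.ofReal ((f x - f y) ^ 2)) :=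
  (((hf.comp measurable_fst).sub (hf.comp measurable_snd)).pow_const 2).ennreal_ofReal

theorem pairEnergy_comm [SFinite μ] (hf : Measurable f) (S S' : Set α) :
    pairEnergy μ f S S' = pairEnergy μ f S' S := by
  unfold pairEnergy
  rw [lintegral_lintegral_swap (measurable_ofReal_sq_sub hf).aemeasurable]
  simp_rw [fun x y => (by ring : (f x - f y) ^ 2 = (f y - f x) ^ 2)]

theorem pairEnergy_mono {S₁ S₂ S₁' S₂' : Set α} (h : S₁ ⊆ S₂) (h' : S₁' ⊆ S₂') :
    pairEnergy μ f S₁ S₁' ≤ pairEnergy μ f S₂ S₂' :=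
  lintegral_mono' (Measure.restrict_mono h le_rfl) fun _ => lintegral_mono_set h'

theorem pairEnergy_union_left_le (S T S' : Set α) :
    pairEnergy μ f (S ∪ T) S' ≤ pairEnergy μ f S S' + pairEnergy μ f T S' :=
  lintegral_union_le _ _ _

theorem pairEnergy_trans_le [SFinite μ] (hf : Measurable f) (A B C : Set α) :
    μ B * pairEnergy μ f A C ≤
      2 * μ C * pairEnergy μ f A B + 2 * μ A * pairEnergy μ f C B := by
  have hm := measurable_ofReal_sq_sub hf
  have hx : ∀ x, Measurable fun y => ENNReal.ofReal ((f x - f y) ^ 2) := fun x =>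
    ((measurable_const.sub hf).pow_const 2).ennreal_ofReal
  set φ : α → ℝ≥0∞ := fun x => ∫⁻ z in B, ENNReal.ofReal ((f x - f z) ^ 2) ∂μ with hφ
  have hφm : Measurable φ := hm.lintegral_prod_right'
  have hpt : ∀ x y, μ B * ENNReal.ofReal ((f x - f y) ^ 2) ≤ 2 * φ x + 2 * φ y := by
    intro x y
    rw [hφ, ← lintegral_const_mul _ (hx x), ← lintegral_const_mul _ (hx y),
      ← lintegral_add_left ((hx x).const_mul 2), mul_comm, ← setLIntegral_const]
    refine lintegral_mono fun z => ?_
    rw [← mul_add, ← ENNReal.ofReal_add (sq_nonneg _) (sq_nonneg _), ← ENNReal.ofReal_ofNat,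
      ← ENNReal.ofReal_mul (by norm_num)]
    refine ENNReal.ofReal_le_ofReal ?_
    nlinarith [sq_nonneg (f x - f z + (f y - f z))]
  calc μ B * pairEnergy μ f A C
      = ∫⁻ x in A, ∫⁻ y in C, μ B * ENNReal.ofReal ((f x - f y) ^ 2) ∂μ ∂μ := by
        unfold pairEnergy
        have hC : Measurable fun x => ∫⁻ y in C, ENNReal.ofReal ((f x - f y) ^ 2) ∂μ :=
          hm.lintegral_prod_right'
        rw [← lintegral_const_mul _ hC]
        refine lintegral_congr fun x => ?_
        rw [lintegral_const_mul _ (hx x)]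
    _ ≤ ∫⁻ x in A, ∫⁻ y in C, (2 * φ x + 2 * φ y) ∂μ ∂μ :=
        lintegral_mono fun x => lintegral_mono fun y => hpt x y
    _ = ∫⁻ x in A, (2 * φ x * μ C + 2 * ∫⁻ y in C, φ y ∂μ) ∂μ := by
        refine lintegral_congr fun x => ?_
        rw [lintegral_add_left measurable_const, setLIntegral_const, lintegral_const_mul _ hφm]
    _ = 2 * (∫⁻ x in A, φ x ∂μ) * μ C + 2 * (∫⁻ y in C, φ y ∂μ) * μ A := by
        rw [lintegral_add_right _ measurable_const, setLIntegral_const,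
          lintegral_mul_const _ (hφm.const_mul 2), lintegral_const_mul _ hφm]
    _ = _ := by
        unfold pairEnergy
        simp only [hφ]
        ring

end PairEnergy

section Chaining

variable {X : Type*} [MetricSpace X] {Γ : Set X} {κ α : Type*} [MeasurableSpace α]

/-- A uniform local bound for a family of measures on a compact set is a global one. -/
theorem exists_measure_preimage_le (hΓ : IsCompact Γ) (μ : κ → Measure α) (p : κ → α → X)
    (hloc : ∀ a ∈ Γ, ∃ s > 0, ∃ M : ℝ≥0, ∀ i, μ i (p i ⁻¹' Metric.ball a s) ≤ M) :
    ∃ M : ℝ≥0, ∀ i, μ i (p i ⁻¹' Γ) ≤ M := by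
  refine hΓ.induction_on (p := fun t => ∃ M : ℝ≥0, ∀ i, μ i (p i ⁻¹' t) ≤ M)
    ⟨0, by simp⟩ ?_ ?_ ?_
  · rintro s t hst ⟨M, hM⟩
    exact ⟨M, fun i => (measure_mono (preimage_mono hst)).trans (hM i)⟩
  · rintro s t ⟨M, hM⟩ ⟨M', hM'⟩
    refine ⟨M + M', fun i => ?_⟩
    rw [preimage_union, ENNReal.coe_add]
    exact (measure_union_le _ _).trans (add_le_add (hM i) (hM' i))
  · intro a ha
    obtain ⟨s, hs, M, hM⟩ := hloc a ha
    exact ⟨Metric.ball a s, mem_nhdsWithin_of_mem_nhds (Metric.ball_mem_nhds a hs), M, hM⟩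

/-- Uniform local Poincaré inequalities over a compact connected set, together with uniform mass
bounds, give a uniform global one. -/
theorem exists_pairEnergy_le (hΓ : IsCompact Γ) (hΓc : IsPreconnected Γ) (μ : κ → Measure α)
    [∀ i, SFinite (μ i)] (f : κ → α → ℝ) (hf : ∀ i, Measurable (f i)) (G : κ → ℝ≥0∞)
    (p : κ → α → X) (M : ℝ≥0) (hM : ∀ i, μ i univ ≤ M)
    (hlow : ∀ a ∈ Γ, ∀ s > 0, ∃ m : ℝ≥0, 0 < m ∧ ∀ i, m ≤ μ i (p i ⁻¹' Metric.ball a s))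
    (hloc : ∀ a ∈ Γ, ∃ s > 0, ∃ C : ℝ≥0, ∀ i,
      pairEnergy (μ i) (f i) (p i ⁻¹' Metric.ball a s) (p i ⁻¹' Metric.ball a s) ≤ C * G i) :
    ∃ C : ℝ≥0, ∀ i, pairEnergy (μ i) (f i) (p i ⁻¹' Γ) (p i ⁻¹' Γ) ≤ C * G i := by
  have hrel : ∀ a ∈ Γ, ∀ b ∈ Γ, ∃ s > 0, ∃ C : ℝ≥0, ∀ i,
      pairEnergy (μ i) (f i) (p i ⁻¹' Metric.ball a s) (p i ⁻¹' Metric.ball b s) ≤ C * G i := by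
    intro a ha b hb
    refine hΓc.induction₂ (fun a b => ∃ s > 0, ∃ C : ℝ≥0, ∀ i,
      pairEnergy (μ i) (f i) (p i ⁻¹' Metric.ball a s) (p i ⁻¹' Metric.ball b s) ≤ C * G i)
      ?_ ?_ ?_ ha hb
    · intro x hx
      obtain ⟨s, hs, C, hC⟩ := hloc x hx
      filter_upwards [mem_nhdsWithin_of_mem_nhds (Metric.ball_mem_nhds x (half_pos hs))] with y hy
      refine ⟨s / 2, half_pos hs, C, fun i => (pairEnergy_mono ?_ ?_).trans (hC i)⟩
      · exact preimage_mono (Metric.ball_subset_ball (by linarith))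
      · refine preimage_mono (Metric.ball_subset_ball' ?_)
        rw [Metric.mem_ball] at hy
        linarith
    · rintro x y z hx hy hz ⟨s₁, hs₁, C₁, h₁⟩ ⟨s₂, hs₂, C₂, h₂⟩
      obtain ⟨m, hm, hm'⟩ := hlow y hy (min s₁ s₂) (lt_min hs₁ hs₂)
      refine ⟨min s₁ s₂, lt_min hs₁ hs₂, m⁻¹ * (2 * M * (C₁ + C₂)), fun i => ?_⟩
      have h := pairEnergy_trans_le (μ := μ i) (hf i) (p i ⁻¹' Metric.ball x (min s₁ s₂))
        (p i ⁻¹' Metric.ball y (min s₁ s₂)) (p i ⁻¹' Metric.ball z (min s₁ s₂))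
      have e1 := (pairEnergy_mono (μ := μ i) (f := f i)
        (preimage_mono (f := p i) (Metric.ball_subset_ball (x := x) (min_le_left s₁ s₂)))
        (preimage_mono (f := p i) (Metric.ball_subset_ball (x := y) (min_le_left s₁ s₂)))).trans
        (h₁ i)
      have e2 := (pairEnergy_mono (μ := μ i) (f := f i)
        (preimage_mono (f := p i) (Metric.ball_subset_ball (x := y) (min_le_right s₁ s₂)))
        (preimage_mono (f := p i) (Metric.ball_subset_ball (x := z) (min_le_right s₁ s₂)))).trans
        (h₂ i)
      rw [pairEnergy_comm (hf i)] at e2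
      have hMi : ∀ S, μ i S ≤ M := fun S => (measure_mono (subset_univ S)).trans (hM i)
      have h3 : m * pairEnergy (μ i) (f i) (p i ⁻¹' Metric.ball x (min s₁ s₂))
          (p i ⁻¹' Metric.ball z (min s₁ s₂)) ≤ 2 * M * (C₁ * G i) + 2 * M * (C₂ * G i) :=
        (mul_le_mul_left (hm' i) _).trans (h.trans
          (add_le_add (mul_le_mul' (mul_le_mul_right (hMi _) _) e1)
            (mul_le_mul' (mul_le_mul_right (hMi _) _) e2)))
      push_cast
      rw [ENNReal.coe_inv hm.ne', mul_assoc, ← ENNReal.div_eq_inv_mul,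
        ENNReal.le_div_iff_mul_le (Or.inl (by simpa using hm.ne')) (Or.inl ENNReal.coe_ne_top),
        mul_comm]
      refine h3.trans (le_of_eq (by ring))
    · rintro x y hx hy ⟨s, hs, C, hC⟩
      refine ⟨s, hs, C, fun i => ?_⟩
      rw [pairEnergy_comm (hf i)]
      exact hC i
  have hhalf : ∀ a ∈ Γ, ∃ s > 0, ∃ C : ℝ≥0, ∀ i,
      pairEnergy (μ i) (f i) (p i ⁻¹' Γ) (p i ⁻¹' Metric.ball a s) ≤ C * G i := by
    intro a ha
    refine hΓ.induction_on (p := fun t => ∃ s > 0, ∃ C : ℝ≥0, ∀ i,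
      pairEnergy (μ i) (f i) (p i ⁻¹' t) (p i ⁻¹' Metric.ball a s) ≤ C * G i) ?_ ?_ ?_ ?_
    · exact ⟨1, one_pos, 0, by simp [pairEnergy]⟩
    · rintro s t hst ⟨r, hr, C, hC⟩
      exact ⟨r, hr, C, fun i => (pairEnergy_mono (preimage_mono hst) subset_rfl).trans (hC i)⟩
    · rintro s t ⟨r, hr, C, hC⟩ ⟨r', hr', C', hC'⟩
      refine ⟨min r r', lt_min hr hr', C + C', fun i => ?_⟩
      rw [preimage_union, ENNReal.coe_add, add_mul]
      refine (pairEnergy_union_left_le _ _ _).trans (add_le_add ?_ ?_)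
      · exact (pairEnergy_mono subset_rfl
          (preimage_mono (Metric.ball_subset_ball (min_le_left _ _)))).trans (hC i)
      · exact (pairEnergy_mono subset_rfl
          (preimage_mono (Metric.ball_subset_ball (min_le_right _ _)))).trans (hC' i)
    · intro b hb
      obtain ⟨s, hs, C, hC⟩ := hrel b hb a ha
      exact ⟨Metric.ball b s, mem_nhdsWithin_of_mem_nhds (Metric.ball_mem_nhds b hs), s, hs, C, hC⟩
  refine hΓ.induction_on (p := fun t => ∃ C : ℝ≥0, ∀ i,
    pairEnergy (μ i) (f i) (p i ⁻¹' t) (p i ⁻¹' Γ) ≤ C * G i) ?_ ?_ ?_ ?_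
  · exact ⟨0, by simp [pairEnergy]⟩
  · rintro s t hst ⟨C, hC⟩
    exact ⟨C, fun i => (pairEnergy_mono (preimage_mono hst) subset_rfl).trans (hC i)⟩
  · rintro s t ⟨C, hC⟩ ⟨C', hC'⟩
    refine ⟨C + C', fun i => ?_⟩
    rw [preimage_union, ENNReal.coe_add, add_mul]
    exact (pairEnergy_union_left_le _ _ _).trans (add_le_add (hC i) (hC' i))
  · intro a ha
    obtain ⟨s, hs, C, hC⟩ := hhalf a ha
    refine ⟨Metric.ball a s, mem_nhdsWithin_of_mem_nhds (Metric.ball_mem_nhds a hs), C,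
      fun i => ?_⟩
    rw [pairEnergy_comm (hf i)]
    exact hC i

end Chaining

variable {k d c : ℕ}

local notation "𝔼" k => EuclideanSpace ℝ (Fin k)

/-- `ψ` parametrizes a neighbourhood in `M` of the point over `a` by the ball of radius `r`, with
bi-Lipschitz constant `L`; neighbourhoods are measured after applying `π`. -/
structure IsLipChart (M : Set (𝔼 k)) (π : (𝔼 k) → 𝔼 k) (r L : ℝ) (a : 𝔼 k)
    (ψ : (𝔼 d) → 𝔼 k) : Prop where
  dist_le : ∀ u ∈ Metric.ball 0 r, dist (π (ψ u)) a ≤ L * ‖u‖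
  mapsTo : ∀ u ∈ Metric.ball 0 r, ψ u ∈ M
  norm_sub_le : ∀ u ∈ Metric.ball 0 r, ∀ u' ∈ Metric.ball 0 r, ‖ψ u - ψ u'‖ ≤ L * ‖u - u'‖
  le_norm_sub : ∀ u ∈ Metric.ball 0 r, ∀ u' ∈ Metric.ball 0 r, ‖u - u'‖ ≤ L * ‖ψ u - ψ u'‖
  mem_image : ∀ b ∈ M, dist (π b) a < r / L → b ∈ ψ '' Metric.ball 0 r

theorem IsLipChart.center {M : Set (𝔼 k)} {π : (𝔼 k) → 𝔼 k} {r L : ℝ} {a : 𝔼 k}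
    {ψ : (𝔼 d) → 𝔼 k} (h : IsLipChart M π r L a ψ) (hr : 0 < r) : π (ψ 0) = a := by
  have h1 := h.dist_le 0 (Metric.mem_ball_self hr)
  rw [norm_zero, mul_zero] at h1
  exact dist_le_zero.1 h1

/-- A smooth local parametrization of `Γ` on the ball of radius `R` about `u₀`, with quantitative
bounds. -/
structure IsSmoothChart (Γ : Set (𝔼 k)) (R L : ℝ) (u₀ : 𝔼 d) (ψ : (𝔼 d) → 𝔼 k)
    (ψ' : (𝔼 d) → (𝔼 d) →L[ℝ] 𝔼 k) : Prop where
  mapsTo : ∀ u ∈ Metric.ball u₀ R, ψ u ∈ Γ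
  norm_sub_le : ∀ u ∈ Metric.ball u₀ R, ∀ u' ∈ Metric.ball u₀ R, ‖ψ u - ψ u'‖ ≤ L * ‖u - u'‖
  le_norm_sub : ∀ u ∈ Metric.ball u₀ R, ∀ u' ∈ Metric.ball u₀ R, ‖u - u'‖ ≤ L * ‖ψ u - ψ u'‖
  hasFDerivAt : ∀ u ∈ Metric.ball u₀ R, HasFDerivAt ψ (ψ' u) u
  deriv_sub_le : ∀ u ∈ Metric.ball u₀ R, ∀ u' ∈ Metric.ball u₀ R, ‖ψ' u - ψ' u'‖ ≤ L * ‖u - u'‖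
  tangent_le : ∀ u ∈ Metric.ball u₀ R, ∀ τ ∈ tangentSpace Γ (ψ u), ∃ e, ψ' u e = τ

theorem exists_isSmoothChart {Γ : Set (𝔼 k)} (hΓ : IsSmoothSubmanifold d c Γ) {p : 𝔼 k}
    (hp : p ∈ Γ) :
    ∃ R > 0, ∃ L > 0, ∃ (u₀ : 𝔼 d) (ψ : (𝔼 d) → 𝔼 k) (ψ' : (𝔼 d) → (𝔼 d) →L[ℝ] 𝔼 k),
      IsSmoothChart Γ R L u₀ ψ ψ' ∧
      ∃ ε > 0, ∀ b ∈ Γ, dist b p < ε → ∃ u ∈ Metric.ball u₀ (R / 2), ψ u = b := by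
  obtain ⟨φ, hps, hφ, hφs, hφΓ⟩ := hΓ p hp
  set ι : (𝔼 d) → (𝔼 d) × (𝔼 c) := fun u => (u, 0) with hι
  have hιc : ContDiff ℝ ∞ ι := contDiff_id.prodMk contDiff_const
  set u₀ := (φ p).1 with hu₀
  have hιu : ι u₀ = φ p := Prod.ext rfl ((hφΓ p hps).1 hp).symm
  set ψ : (𝔼 d) → 𝔼 k := fun u => φ.symm (ι u) with hψ
  have hψu₀ : ψ u₀ = p := by simp only [hψ]; rw [hιu, φ.left_inv hps]
  -- smoothness on the open set of parameters
  set O : Set (𝔼 d) := ι ⁻¹' φ.target with hO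
  have hOo : IsOpen O := φ.open_target.preimage hιc.continuous
  have hu₀O : u₀ ∈ O := by
    show ι u₀ ∈ φ.target
    rw [hιu]; exact φ.map_source hps
  have hψc : ∀ u ∈ O, ContDiffAt ℝ ∞ ψ u := fun u hu =>
    ((hφs (ι u) hu).contDiffAt (φ.open_target.mem_nhds hu)).comp u hιc.contDiffAt
  have hφc : ∀ x ∈ φ.source, ContDiffAt ℝ ∞ φ x := fun x hx =>
    (hφ x hx).contDiffAt (φ.open_source.mem_nhds hx)
  have hinv : ∀ u ∈ O, φ (ψ u) = ι u := fun u hu => φ.right_inv hu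
  have hsrc : ∀ u ∈ O, ψ u ∈ φ.source := fun u hu => φ.map_target hu
  have hΓψ : ∀ u ∈ O, ψ u ∈ Γ := fun u hu => (hφΓ _ (hsrc u hu)).2 (by rw [hinv u hu])
  have hψφ : ∀ x ∈ φ.source, x ∈ Γ → ψ (φ x).1 = x := fun x hx hxΓ => by
    have : ι (φ x).1 = φ x := Prod.ext rfl ((hφΓ x hx).1 hxΓ).symm
    simp only [hψ]; rw [this, φ.left_inv hx]
  -- Lipschitz bounds
  obtain ⟨K₁, t₁, ht₁, hK₁⟩ :=
    ((hψc u₀ hu₀O).of_le (by norm_cast)).exists_lipschitzOnWith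
  have hdc : ContDiffAt ℝ 1 (fderiv ℝ ψ) u₀ :=
    (hψc u₀ hu₀O).fderiv_right (m := 1) (by norm_cast)
  obtain ⟨K₂, t₂, ht₂, hK₂⟩ := hdc.exists_lipschitzOnWith
  obtain ⟨K₃, t₃, ht₃, hK₃⟩ :=
    ((hφc p hps).of_le (by norm_cast)).exists_lipschitzOnWith
  have hψcont : ContinuousAt ψ u₀ := (hψc u₀ hu₀O).continuousAt
  have hpre : ψ ⁻¹' t₃ ∈ 𝓝 u₀ := hψcont (by rw [hψu₀]; exact ht₃)
  obtain ⟨R, hR, hRsub⟩ := Metric.mem_nhds_iff.1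
    (Filter.inter_mem (Filter.inter_mem ht₁ ht₂) (Filter.inter_mem hpre (hOo.mem_nhds hu₀O)))
  refine ⟨R, hR, K₁ + K₂ + K₃ + 1, by positivity, u₀, ψ, fderiv ℝ ψ, ⟨?_, ?_, ?_, ?_, ?_, ?_⟩, ?_⟩
  · exact fun u hu => hΓψ u (hRsub hu).2.2
  · intro u hu u' hu'
    have := hK₁.dist_le_mul u (hRsub hu).1.1 u' (hRsub hu').1.1
    rw [dist_eq_norm, dist_eq_norm] at this
    refine this.trans (mul_le_mul_of_nonneg_right ?_ (norm_nonneg _))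
    linarith [K₂.2, K₃.2]
  · intro u hu u' hu'
    have := hK₃.dist_le_mul _ (hRsub hu).2.1 _ (hRsub hu').2.1
    rw [hinv u (hRsub hu).2.2, hinv u' (hRsub hu').2.2, dist_eq_norm (ψ u)] at this
    have h2 : ‖u - u'‖ ≤ dist (ι u) (ι u') := by
      rw [← dist_eq_norm, Prod.dist_eq]; exact le_max_left _ _
    refine (h2.trans this).trans (mul_le_mul_of_nonneg_right ?_ (norm_nonneg _))
    linarith [K₁.2, K₂.2]
  · intro u hu
    exact ((hψc u (hRsub hu).2.2).differentiableAt (by simp)).hasFDerivAt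
  · intro u hu u' hu'
    have := hK₂.dist_le_mul u (hRsub hu).1.2 u' (hRsub hu').1.2
    rw [dist_eq_norm, dist_eq_norm] at this
    refine this.trans (mul_le_mul_of_nonneg_right ?_ (norm_nonneg _))
    linarith [K₁.2, K₃.2]
  · intro u hu τ hτ
    have hu' := (hRsub hu).2.2
    suffices h : tangentSpace Γ (ψ u) ≤ LinearMap.range (fderiv ℝ ψ u : (𝔼 d) →ₗ[ℝ] 𝔼 k) from
      h hτ
    refine Submodule.span_le.2 ?_
    rintro w ⟨γ, hγ0, hγΓ, hγ⟩
    have hφd : HasFDerivAt φ (fderiv ℝ φ (γ 0)) (γ 0) :=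
      ((hφc _ (by rw [hγ0]; exact hsrc u hu')).differentiableAt (by simp)).hasFDerivAt
    have h1 : HasDerivAt (fun t => (φ (γ t)).1) (fderiv ℝ φ (γ 0) w).1 0 :=
      (ContinuousLinearMap.fst ℝ (𝔼 d) (𝔼 c)).hasFDerivAt.comp_hasDerivAt (0 : ℝ)
        (hφd.comp_hasDerivAt (0 : ℝ) hγ)
    have h0 : (φ (γ 0)).1 = u := by rw [hγ0, hinv u hu']
    have h2 : HasDerivAt (fun t => ψ (φ (γ t)).1) (fderiv ℝ ψ u (fderiv ℝ φ (γ 0) w).1) 0 := by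
      have h4 : HasFDerivAt ψ (fderiv ℝ ψ u) (φ (γ 0)).1 := by
        rw [h0]
        exact ((hψc u hu').differentiableAt (by simp)).hasFDerivAt
      exact h4.comp_hasDerivAt (0 : ℝ) h1
    have h3 : γ =ᶠ[𝓝 0] fun t => ψ (φ (γ t)).1 := by
      have : ∀ᶠ t in 𝓝 (0 : ℝ), γ t ∈ φ.source :=
        hγ.continuousAt (φ.open_source.mem_nhds (by rw [hγ0]; exact hsrc u hu'))
      filter_upwards [this] with t ht
      exact (hψφ _ ht (hγΓ t)).symm
    exact ⟨_, (h2.congr_of_eventuallyEq h3).unique hγ⟩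
  · have h1 : ContinuousAt (fun x => (φ x).1) p := (hφc p hps).continuousAt.fst
    have h2 : ∀ᶠ x in 𝓝 p, (φ x).1 ∈ Metric.ball u₀ (R / 2) :=
      h1 (Metric.ball_mem_nhds _ (half_pos hR))
    obtain ⟨ε, hε, hεsub⟩ := Metric.eventually_nhds_iff.1
      (h2.and (φ.open_source.mem_nhds hps))
    exact ⟨ε, hε, fun b hb hbp => ⟨(φ b).1, (hεsub hbp).1, hψφ b (hεsub hbp).2 hb⟩⟩

namespace IsSmoothChart

variable {Γ : Set (𝔼 k)} {R L : ℝ} {u₀ : 𝔼 d} {ψ : (𝔼 d) → 𝔼 k} {ψ' : (𝔼 d) → (𝔼 d) →L[ℝ] 𝔼 k}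

theorem taylor_le (h : IsSmoothChart Γ R L u₀ ψ ψ') (hL : 0 < L) {u u' : 𝔼 d}
    (hu : u ∈ Metric.ball u₀ R) (hu' : u' ∈ Metric.ball u₀ R) :
    ‖ψ u' - ψ u - ψ' u (u' - u)‖ ≤ L * ‖u' - u‖ ^ 2 := by
  have hseg : segment ℝ u u' ⊆ Metric.ball u₀ R := (convex_ball u₀ R).segment_subset hu hu'
  have h1 := (convex_segment u u').norm_image_sub_le_of_norm_hasFDerivWithin_le'
    (f := ψ) (f' := ψ') (φ := ψ' u) (C := L * ‖u' - u‖)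
    (fun x hx => (h.hasFDerivAt x (hseg hx)).hasFDerivWithinAt)
    (fun x hx => by
      refine (h.deriv_sub_le x (hseg hx) u hu).trans ?_
      gcongr
      rw [← dist_eq_norm, ← dist_eq_norm, dist_comm x, dist_comm u']
      have := dist_add_dist_of_mem_segment hx
      linarith [dist_nonneg (x := x) (y := u')])
    (left_mem_segment ℝ u u') (right_mem_segment ℝ u u')
  refine h1.trans (le_of_eq (by ring))

theorem norm_le_deriv (h : IsSmoothChart Γ R L u₀ ψ ψ') (hL : 0 < L) {u : 𝔼 d}
    (hu : u ∈ Metric.ball u₀ R) (e : 𝔼 d) : ‖e‖ ≤ L * ‖ψ' u e‖ := by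
  have hlim : Filter.Tendsto (fun t : ℝ => L * ‖ψ' u e‖ + L ^ 2 * ‖e‖ ^ 2 * t) (𝓝[>] 0)
      (𝓝 (L * ‖ψ' u e‖ + L ^ 2 * ‖e‖ ^ 2 * 0)) :=
    ((continuous_const.add (continuous_const.mul continuous_id)).tendsto 0).mono_left
      nhdsWithin_le_nhds
  rw [mul_zero, add_zero] at hlim
  refine ge_of_tendsto hlim ?_
  have hmem : ∀ᶠ t : ℝ in 𝓝 0, u + t • e ∈ Metric.ball u₀ R := by
    have : ContinuousAt (fun t : ℝ => u + t • e) 0 := by fun_prop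
    exact this (by simpa using Metric.isOpen_ball.mem_nhds hu)
  filter_upwards [nhdsWithin_le_nhds hmem, self_mem_nhdsWithin] with t ht ht0
  rw [mem_Ioi] at ht0
  have h1 := h.le_norm_sub _ ht _ hu
  have h2 := h.taylor_le hL hu ht
  rw [add_sub_cancel_left, norm_smul, Real.norm_eq_abs, abs_of_pos ht0] at h1 h2
  rw [map_smul] at h2
  have h3 : ‖ψ (u + t • e) - ψ u‖ ≤ t * ‖ψ' u e‖ + L * (t * ‖e‖) ^ 2 := by
    have := norm_le_norm_add_norm_sub' (ψ (u + t • e) - ψ u) (t • ψ' u e)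
    rw [norm_smul, Real.norm_eq_abs, abs_of_pos ht0] at this
    linarith
  have h4 : t * ‖e‖ ≤ t * (L * ‖ψ' u e‖ + L ^ 2 * ‖e‖ ^ 2 * t) := by
    calc t * ‖e‖ ≤ L * (t * ‖ψ' u e‖ + L * (t * ‖e‖) ^ 2) := h1.trans (by gcongr)
      _ = _ := by ring
  exact le_of_mul_le_mul_left h4 ht0

theorem deriv_mem_tangentSpace (h : IsSmoothChart Γ R L u₀ ψ ψ') {u : 𝔼 d}
    (hu : u ∈ Metric.ball u₀ R) (e : 𝔼 d) : ψ' u e ∈ tangentSpace Γ (ψ u) := by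
  obtain ⟨δ, hδ, hsub⟩ := Metric.isOpen_iff.1 Metric.isOpen_ball u hu
  set s := δ / (‖e‖ + 1) with hs
  have hs0 : 0 < s := by positivity
  refine Submodule.subset_span ⟨fun t => ψ (u + (s * Real.sin (t / s)) • e), by simp, ?_, ?_⟩
  · intro t
    refine h.mapsTo _ (hsub ?_)
    rw [Metric.mem_ball, dist_eq_norm, add_sub_cancel_left, norm_smul, Real.norm_eq_abs, abs_mul,
      abs_of_pos hs0]
    calc s * |Real.sin (t / s)| * ‖e‖ ≤ s * 1 * ‖e‖ := by
          gcongr; exact Real.abs_sin_le_one _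
      _ < s * (‖e‖ + 1) := by nlinarith
      _ = δ := by rw [hs]; field_simp
  · have h1 : HasDerivAt (fun t : ℝ => s * Real.sin (t / s)) 1 0 := by
      have := (((hasDerivAt_id (0 : ℝ)).div_const s).sin).const_mul s
      simpa [hs0.ne'] using this
    have h2 : HasDerivAt (fun t : ℝ => u + (s * Real.sin (t / s)) • e) e 0 := by
      simpa using (h1.smul_const e).const_add u
    have h3 := HasFDerivAt.comp_hasDerivAt (0 : ℝ) (l := ψ)
      (f := fun t : ℝ => u + (s * Real.sin (t / s)) • e) (l' := ψ' u)
      (by simpa using h.hasFDerivAt u hu) h2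
    exact h3

end IsSmoothChart

/-- A monotone relation between points of a compact set that holds locally, and away from the
diagonal, holds with a uniform constant. -/
theorem exists_forall_of_local {X : Type*} [MetricSpace X] {Γ : Set X} (hΓ : IsCompact Γ)
    (P : ℝ → X → X → Prop) (hmono : ∀ C C' a b, C ≤ C' → P C a b → P C' a b)
    (hloc : ∀ p ∈ Γ, ∃ ε > 0, ∃ C, ∀ a ∈ Γ, ∀ b ∈ Γ, dist a p < ε → dist b p < ε → P C a b)
    (hfar : ∀ η > 0, ∃ C, ∀ a ∈ Γ, ∀ b ∈ Γ, η ≤ dist a b → P C a b) :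
    ∃ C > 0, ∀ a ∈ Γ, ∀ b ∈ Γ, P C a b := by
  have key : ∃ C, ∀ q ∈ Γ ×ˢ Γ, q ∈ Γ ×ˢ Γ → P C q.1 q.2 := by
    refine (hΓ.prod hΓ).induction_on (p := fun t => ∃ C, ∀ q ∈ t, q ∈ Γ ×ˢ Γ → P C q.1 q.2)
      ⟨0, by simp⟩ ?_ ?_ ?_
    · rintro s t hst ⟨C, hC⟩
      exact ⟨C, fun q hq => hC q (hst hq)⟩
    · rintro s t ⟨C, hC⟩ ⟨C', hC'⟩
      refine ⟨max C C', fun q hq hqΓ => ?_⟩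
      rcases hq with hq | hq
      · exact hmono _ _ _ _ (le_max_left _ _) (hC q hq hqΓ)
      · exact hmono _ _ _ _ (le_max_right _ _) (hC' q hq hqΓ)
    · rintro ⟨a, b⟩ ⟨ha, hb⟩
      rcases eq_or_ne a b with rfl | hab
      · obtain ⟨ε, hε, C, hC⟩ := hloc a ha
        refine ⟨Metric.ball a ε ×ˢ Metric.ball a ε, mem_nhdsWithin_of_mem_nhds
          (prod_mem_nhds (Metric.ball_mem_nhds a hε) (Metric.ball_mem_nhds a hε)), C, ?_⟩
        rintro ⟨x, y⟩ ⟨hx, hy⟩ ⟨hxΓ, hyΓ⟩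
        exact hC x hxΓ y hyΓ hx hy
      · have hd : 0 < dist a b / 3 := by have := dist_pos.2 hab; positivity
        obtain ⟨C, hC⟩ := hfar _ hd
        refine ⟨Metric.ball a (dist a b / 3) ×ˢ Metric.ball b (dist a b / 3),
          mem_nhdsWithin_of_mem_nhds
          (prod_mem_nhds (Metric.ball_mem_nhds a hd) (Metric.ball_mem_nhds b hd)), C, ?_⟩
        rintro ⟨x, y⟩ ⟨hx, hy⟩ ⟨hxΓ, hyΓ⟩
        refine hC x hxΓ y hyΓ ?_
        simp only [Metric.mem_ball] at hx hy
        have h1 := dist_triangle4 a x y b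
        rw [dist_comm a x] at h1
        linarith
  obtain ⟨C, hC⟩ := key
  exact ⟨max C 1, by positivity, fun a ha b hb =>
    hmono _ _ _ _ (le_max_left _ _) (hC (a, b) ⟨ha, hb⟩ ⟨ha, hb⟩)⟩

/-- A compact submanifold has positive reach: it separates quadratically from its tangent
planes. -/
theorem exists_inner_normal_le {Γ : Set (𝔼 k)} (hΓ : IsSmoothSubmanifold d c Γ)
    (hΓc : IsCompact Γ) :
    ∃ C > 0, ∀ a ∈ Γ, ∀ b ∈ Γ, ∀ n ∈ (tangentSpace Γ a)ᗮ,
      |inner ℝ n (b - a)| ≤ C * ‖n‖ * ‖b - a‖ ^ 2 := by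
  refine exists_forall_of_local hΓc (fun C a b => ∀ n ∈ (tangentSpace Γ a)ᗮ,
      |inner ℝ n (b - a)| ≤ C * ‖n‖ * ‖b - a‖ ^ 2) ?_ ?_ ?_
  · intro C C' a b hCC h n hn
    exact (h n hn).trans (by gcongr)
  · intro p hp
    obtain ⟨R, hR, L, hL, u₀, ψ, ψ', h, ε, hε, hcov⟩ := exists_isSmoothChart hΓ hp
    refine ⟨ε, hε, L * L ^ 2, ?_⟩
    intro a ha b hb hap hbp n hn
    obtain ⟨u, hu, rfl⟩ := hcov a ha hap
    obtain ⟨u', hu', rfl⟩ := hcov b hb hbp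
    have hball := Metric.ball_subset_ball (x := u₀) (half_le_self hR.le)
    have h1 : inner ℝ n (ψ' u (u' - u)) = 0 := by
      rw [real_inner_comm]
      exact hn _ (h.deriv_mem_tangentSpace (hball hu) _)
    have h2 : inner ℝ n (ψ u' - ψ u) = inner ℝ n (ψ u' - ψ u - ψ' u (u' - u)) := by
      rw [inner_sub_right n (ψ u' - ψ u), h1, sub_zero]
    rw [h2]
    refine (abs_real_inner_le_norm _ _).trans ?_
    have h3 := h.taylor_le hL (hball hu) (hball hu')
    have h4 := h.le_norm_sub _ (hball hu') _ (hball hu)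
    calc ‖n‖ * ‖ψ u' - ψ u - ψ' u (u' - u)‖ ≤ ‖n‖ * (L * (L * ‖ψ u' - ψ u‖) ^ 2) := by
          gcongr
          exact h3.trans (by gcongr)
      _ = _ := by ring
  · intro η hη
    refine ⟨1 / η, fun a ha b hb hab n hn => ?_⟩
    rw [dist_comm, dist_eq_norm] at hab
    refine (abs_real_inner_le_norm _ _).trans ?_
    rw [mul_comm (1 / η), mul_assoc]
    gcongr
    rw [one_div, ← div_eq_inv_mul, le_div_iff₀ hη]
    nlinarith [norm_nonneg (b - a)]

/-- The tangent spaces of a compact submanifold depend on the base point in a Lipschitz way. -/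
theorem exists_inner_tangent_normal_le {Γ : Set (𝔼 k)} (hΓ : IsSmoothSubmanifold d c Γ)
    (hΓc : IsCompact Γ) :
    ∃ C > 0, ∀ a ∈ Γ, ∀ b ∈ Γ, ∀ τ ∈ tangentSpace Γ a, ∀ n ∈ (tangentSpace Γ b)ᗮ,
      |inner ℝ τ n| ≤ C * ‖a - b‖ * ‖τ‖ * ‖n‖ := by
  refine exists_forall_of_local hΓc (fun C a b => ∀ τ ∈ tangentSpace Γ a,
    ∀ n ∈ (tangentSpace Γ b)ᗮ, |inner ℝ τ n| ≤ C * ‖a - b‖ * ‖τ‖ * ‖n‖) ?_ ?_ ?_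
  · intro C C' a b hCC h τ hτ n hn
    exact (h τ hτ n hn).trans (by gcongr)
  · intro p hp
    obtain ⟨R, hR, L, hL, u₀, ψ, ψ', h, ε, hε, hcov⟩ := exists_isSmoothChart hΓ hp
    refine ⟨ε, hε, L * L * L, ?_⟩
    intro a ha b hb hap hbp τ hτ n hn
    obtain ⟨u, hu, rfl⟩ := hcov a ha hap
    obtain ⟨u', hu', rfl⟩ := hcov b hb hbp
    have hball := Metric.ball_subset_ball (x := u₀) (half_le_self hR.le)
    obtain ⟨e, rfl⟩ := h.tangent_le u (hball hu) τ hτ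
    have h1 : inner ℝ (ψ' u' e) n = 0 := hn _ (h.deriv_mem_tangentSpace (hball hu') _)
    have h2 : inner ℝ (ψ' u e) n = inner ℝ ((ψ' u - ψ' u') e) n := by
      rw [sub_apply, inner_sub_left, h1, sub_zero]
    rw [h2]
    refine (abs_real_inner_le_norm _ _).trans ?_
    have h3 := h.deriv_sub_le _ (hball hu) _ (hball hu')
    have h4 := h.le_norm_sub _ (hball hu) _ (hball hu')
    have h5 := h.norm_le_deriv hL (hball hu) e
    calc ‖(ψ' u - ψ' u') e‖ * ‖n‖ ≤ (L * (L * ‖ψ u - ψ u'‖)) * (L * ‖ψ' u e‖) * ‖n‖ := by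
          gcongr
          refine (ContinuousLinearMap.le_opNorm _ _).trans ?_
          gcongr
          exact h3.trans (by gcongr)
      _ = _ := by ring
  · intro η hη
    refine ⟨1 / η, fun a ha b hb hab τ hτ n hn => ?_⟩
    rw [dist_eq_norm] at hab
    refine (abs_real_inner_le_norm _ _).trans ?_
    gcongr
    rw [one_div, ← div_eq_inv_mul]
    refine le_mul_of_one_le_left (norm_nonneg _) ?_
    rwa [one_le_div hη]

theorem IsLipChart.mono {M : Set (𝔼 k)} {r r' L L' : ℝ} {a : 𝔼 k}
    {ψ : (𝔼 d) → 𝔼 k} (h : IsLipChart M id r L a ψ) (hr' : 0 < r') (hr : r' ≤ r) (hL0 : 0 < L)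
    (hL : L ≤ L') : IsLipChart M id r' L' a ψ := by
  have hball := Metric.ball_subset_ball (x := (0 : 𝔼 d)) hr
  refine ⟨fun u hu => (h.dist_le u (hball hu)).trans (by gcongr),
    fun u hu => h.mapsTo u (hball hu), fun u hu u' hu' =>
    (h.norm_sub_le u (hball hu) u' (hball hu')).trans (by gcongr), fun u hu u' hu' =>
    (h.le_norm_sub u (hball hu) u' (hball hu')).trans (by gcongr), fun b hb hba => ?_⟩
  have hbaL : dist b a < r' / L := hba.trans_le (by gcongr)
  obtain ⟨u, hu, rfl⟩ := h.mem_image b hb (hbaL.trans_le (by gcongr))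
  refine ⟨u, ?_, rfl⟩
  have hr0 : 0 < r := hr'.trans_le hr
  have h1 := h.le_norm_sub u hu 0 (Metric.mem_ball_self hr0)
  have hc : ψ 0 = a := h.center hr0
  rw [hc, ← dist_eq_norm (ψ u), sub_zero] at h1
  rw [mem_ball_zero_iff]
  refine h1.trans_lt ?_
  rwa [lt_div_iff₀ hL0, mul_comm] at hbaL

/-- A compact submanifold has bi-Lipschitz parametrizations of uniform size around all of its
points. -/
theorem exists_isLipChart {Γ : Set (𝔼 k)} (hΓ : IsSmoothSubmanifold d c Γ) (hΓc : IsCompact Γ) :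
    ∃ r > 0, ∃ L ≥ 1, ∀ a ∈ Γ, ∃ ψ : (𝔼 d) → 𝔼 k, IsLipChart Γ id r L a ψ := by
  have key : ∃ r > 0, ∃ L ≥ 1, ∀ a ∈ Γ, a ∈ Γ → ∃ ψ : (𝔼 d) → 𝔼 k, IsLipChart Γ id r L a ψ := by
    refine hΓc.induction_on (p := fun t => ∃ r > 0, ∃ L ≥ 1, ∀ a ∈ t, a ∈ Γ →
      ∃ ψ : (𝔼 d) → 𝔼 k, IsLipChart Γ id r L a ψ) ⟨1, one_pos, 1, le_rfl, by simp⟩ ?_ ?_ ?_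
    · rintro s t hst ⟨r, hr, L, hL, h⟩
      exact ⟨r, hr, L, hL, fun a ha => h a (hst ha)⟩
    · rintro s t ⟨r, hr, L, hL, h⟩ ⟨r', hr', L', hL', h'⟩
      refine ⟨min r r', lt_min hr hr', max L L', le_max_of_le_left hL, ?_⟩
      rintro a (ha | ha) haΓ
      · obtain ⟨ψ, hψ⟩ := h a ha haΓ
        exact ⟨ψ, hψ.mono (lt_min hr hr') (min_le_left _ _) (by linarith)
          (le_max_left _ _)⟩
      · obtain ⟨ψ, hψ⟩ := h' a ha haΓ
        exact ⟨ψ, hψ.mono (lt_min hr hr') (min_le_right _ _) (by linarith)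
          (le_max_right _ _)⟩
    · intro p hp
      obtain ⟨R, hR, L, hL, u₀, ψ, ψ', h, ε, hε, hcov⟩ := exists_isSmoothChart hΓ hp
      set L' := max (max L 1) (R / ε) with hL'
      have hL1 : 1 ≤ L' := le_max_of_le_left (le_max_right _ _)
      have hLL : L ≤ L' := le_max_of_le_left (le_max_left _ _)
      have hLε : R / 2 / L' ≤ ε / 2 := by
        have : R / ε ≤ L' := le_max_right _ _
        rw [div_le_iff₀ hε] at this
        rw [div_le_iff₀ (by linarith)]
        linarith
      refine ⟨Metric.ball p (ε / 2), mem_nhdsWithin_of_mem_nhds (Metric.ball_mem_nhds p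
        (half_pos hε)), R / 2, half_pos hR, L', hL1, fun a ha haΓ => ?_⟩
      rw [Metric.mem_ball] at ha
      obtain ⟨ua, hua, rfl⟩ := hcov a haΓ (by linarith)
      have hsub : ∀ u ∈ Metric.ball (0 : 𝔼 d) (R / 2), ua + u ∈ Metric.ball u₀ R := by
        intro u hu
        rw [Metric.mem_ball, dist_eq_norm] at hua ⊢
        rw [mem_ball_zero_iff] at hu
        calc ‖ua + u - u₀‖ = ‖(ua - u₀) + u‖ := by congr 1; abel
          _ ≤ ‖ua - u₀‖ + ‖u‖ := norm_add_le _ _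
          _ < R := by linarith
      refine ⟨fun u => ψ (ua + u), fun u hu => ?_, fun u hu => h.mapsTo _ (hsub u hu), ?_, ?_, ?_⟩
      · have := h.norm_sub_le _ (hsub u hu) ua
          (Metric.ball_subset_ball (half_le_self hR.le) hua)
        rw [add_sub_cancel_left] at this
        rw [id, dist_eq_norm]
        exact this.trans (by gcongr)
      · intro u hu u' hu'
        have := h.norm_sub_le _ (hsub u hu) _ (hsub u' hu')
        rw [add_sub_add_left_eq_sub] at this
        exact this.trans (by gcongr)
      · intro u hu u' hu'
        have := h.le_norm_sub _ (hsub u hu) _ (hsub u' hu')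
        rw [add_sub_add_left_eq_sub] at this
        exact this.trans (by gcongr)
      · intro b hb hba
        simp only [id] at hba
        have hbp : dist b p < ε := by
          have := dist_triangle b (ψ ua) p
          linarith
        obtain ⟨ub, hub, rfl⟩ := hcov b hb hbp
        refine ⟨ub - ua, ?_, by simp⟩
        have hball := Metric.ball_subset_ball (x := u₀) (half_le_self hR.le)
        have h1 := h.le_norm_sub _ (hball hub) _ (hball hua)
        rw [mem_ball_zero_iff]
        rw [← dist_eq_norm (ψ ub)] at h1
        rw [lt_div_iff₀ (by linarith)] at hba
        have h2 : L * dist (ψ ub) (ψ ua) ≤ L' * dist (ψ ub) (ψ ua) := by gcongr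
        linarith
  obtain ⟨r, hr, L, hL, h⟩ := key
  exact ⟨r, hr, L, hL, fun a ha => h a ha ha⟩

theorem isCompact_simplex (s : Finset (𝔼 k)) : IsCompact (simplex s) :=
  s.finite_toSet.isCompact_convexHull ℝ

theorem convex_simplex (s : Finset (𝔼 k)) : Convex ℝ (simplex s) := convex_convexHull ℝ _

theorem Mesh.isCompact_carrier {m : ℕ} (M : Mesh m k) : IsCompact M.carrier :=
  M.cells.isCompact_biUnion fun s _ => isCompact_simplex s

theorem Mesh.simplex_subset_carrier {m : ℕ} (M : Mesh m k) {s : Finset (𝔼 k)} (hs : s ∈ M.cells) :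
    simplex s ⊆ M.carrier := subset_biUnion_of_mem (u := fun s => simplex s) hs

theorem isClosestPoint_closestPoint {Γ : Set (𝔼 k)} (hΓ : IsCompact Γ) (hne : Γ.Nonempty)
    (x : 𝔼 k) : IsClosestPoint Γ x (closestPoint Γ x) := by
  obtain ⟨q, hq, h⟩ := hΓ.exists_infDist_eq_dist hne x
  exact Classical.epsilon_spec (p := IsClosestPoint Γ x) ⟨q, hq, h.symm⟩

theorem IsClosestPoint.sub_mem_orthogonal {Γ : Set (𝔼 k)} {x q : 𝔼 k} (h : IsClosestPoint Γ x q) :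
    x - q ∈ (tangentSpace Γ q)ᗮ := by
  suffices h' : tangentSpace Γ q ≤ (ℝ ∙ (x - q))ᗮ by
    intro τ hτ
    exact Submodule.mem_orthogonal_singleton_iff_inner_left.1 (h' hτ)
  refine Submodule.span_le.2 ?_
  rintro w ⟨γ, hγ0, hγΓ, hγ⟩
  have h1 : HasDerivAt (fun t => ‖x - γ t‖ ^ 2) (2 * inner ℝ (x - γ 0) (-w)) 0 := by
    have := (hγ.const_sub x).norm_sq
    simpa using this
  have hmin : IsLocalMin (fun t => ‖x - γ t‖ ^ 2) 0 := by
    refine Filter.Eventually.of_forall fun t => ?_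
    simp only
    gcongr
    rw [← dist_eq_norm, ← dist_eq_norm, hγ0, h.2]
    exact Metric.infDist_le_dist_of_mem (hγΓ t)
  have h2 := hmin.hasDerivAt_eq_zero h1
  rw [hγ0, inner_neg_right] at h2
  rw [SetLike.mem_coe, Submodule.mem_orthogonal_singleton_iff_inner_right]
  linarith

/-- The closest point projection is Lipschitz near a set of positive reach. -/
theorem IsClosestPoint.norm_sub_le {Γ : Set (𝔼 k)} {C ε : ℝ} (hC : 0 < C)
    (hreach : ∀ a ∈ Γ, ∀ b ∈ Γ, ∀ n ∈ (tangentSpace Γ a)ᗮ,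
      |inner ℝ n (b - a)| ≤ C * ‖n‖ * ‖b - a‖ ^ 2) (hε : ε * C ≤ 1 / 4)
    {x y a b : 𝔼 k} (hx : IsClosestPoint Γ x a) (hy : IsClosestPoint Γ y b)
    (hxε : Metric.infDist x Γ ≤ ε) (hyε : Metric.infDist y Γ ≤ ε) :
    ‖a - b‖ ≤ 2 * ‖x - y‖ := by
  have h1 := hreach a hx.1 b hy.1 _ hx.sub_mem_orthogonal
  have h2 := hreach b hy.1 a hx.1 _ hy.sub_mem_orthogonal
  have hxa : ‖x - a‖ ≤ ε := by rw [← dist_eq_norm, hx.2]; exact hxε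
  have hyb : ‖y - b‖ ≤ ε := by rw [← dist_eq_norm, hy.2]; exact hyε
  rw [norm_sub_rev b a] at h1
  have h1' : inner ℝ (x - a) (b - a) ≤ 1 / 4 * ‖a - b‖ ^ 2 := by
    refine (le_abs_self _).trans (h1.trans ?_)
    gcongr
    nlinarith
  have h2' : inner ℝ (y - b) (a - b) ≤ 1 / 4 * ‖a - b‖ ^ 2 := by
    refine (le_abs_self _).trans (h2.trans ?_)
    gcongr
    nlinarith
  have h3 : inner ℝ (a - b) (x - y) ≤ ‖a - b‖ * ‖x - y‖ := real_inner_le_norm _ _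
  have h4 : ‖a - b‖ ^ 2 = inner ℝ (a - b) (x - y) + inner ℝ (x - a) (b - a)
      + inner ℝ (y - b) (a - b) := by
    rw [← real_inner_self_eq_norm_sq]
    simp only [inner_sub_left, inner_sub_right]
    rw [real_inner_comm a x, real_inner_comm b x, real_inner_comm a y, real_inner_comm b y,
      real_inner_comm a b]
    ring
  rcases (norm_nonneg (a - b)).eq_or_lt with h0 | h0
  · rw [← h0]; positivity
  · nlinarith

/-- On a flat piece almost parallel to the tangent spaces, the closest point projection is bounded
from below. -/
theorem IsClosestPoint.norm_sub_ge {Γ : Set (𝔼 k)} {C ε : ℝ} (hC : 0 < C)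
    (htan : ∀ a ∈ Γ, ∀ b ∈ Γ, ∀ τ ∈ tangentSpace Γ a, ∀ n ∈ (tangentSpace Γ b)ᗮ,
      |inner ℝ τ n| ≤ C * ‖a - b‖ * ‖τ‖ * ‖n‖) (hε : ε * C ≤ 1)
    {x y a b : 𝔼 k} (hx : IsClosestPoint Γ x a) (hy : IsClosestPoint Γ y b)
    (hyε : Metric.infDist y Γ ≤ ε) {V : Submodule ℝ (𝔼 k)} (hxy : x - y ∈ V)
    (hV : ‖(tangentSpace Γ a).starProjection - V.starProjection‖ ≤ 1 / 2) :
    ‖x - y‖ ≤ 4 * ‖a - b‖ := by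
  set P := (tangentSpace Γ a).starProjection with hP
  have hyb : ‖y - b‖ ≤ ε := by rw [← dist_eq_norm, hy.2]; exact hyε
  have h1 : ‖P (x - y)‖ ≥ ‖x - y‖ / 2 := by
    have h2 := (P - V.starProjection).le_opNorm (x - y)
    rw [sub_apply, Submodule.starProjection_eq_self_iff.2 hxy] at h2
    have h3 : ‖x - y‖ ≤ ‖P (x - y)‖ + ‖P (x - y) - (x - y)‖ := by
      have := norm_le_norm_add_norm_sub (P (x - y)) (x - y)
      linarith
    nlinarith [norm_nonneg (x - y)]
  have hxa : P (x - a) = 0 := by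
    rw [hP, Submodule.starProjection_apply_eq_zero_iff]
    exact hx.sub_mem_orthogonal
  have h2 : P (x - y) = P (a - b) - P (y - b) := by
    have : x - y = (x - a) + ((a - b) - (y - b)) := by abel
    rw [this, map_add, hxa, zero_add, map_sub]
  have h3 : ‖P (y - b)‖ ≤ ‖a - b‖ := by
    have hmem : P (y - b) ∈ tangentSpace Γ a := Submodule.starProjection_apply_mem _ _
    have h4 := htan a hx.1 b hy.1 _ hmem _ hy.sub_mem_orthogonal
    have h5 : inner ℝ (P (y - b)) (y - b) = ‖P (y - b)‖ ^ 2 := by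
      have h6 : inner ℝ (P (y - b)) (y - b - P (y - b)) = 0 :=
        Submodule.sub_starProjection_mem_orthogonal (K := tangentSpace Γ a) (y - b) _ hmem
      rw [inner_sub_right, real_inner_self_eq_norm_sq] at h6
      linarith
    rw [h5, abs_of_nonneg (sq_nonneg _)] at h4
    rcases (norm_nonneg (P (y - b))).eq_or_lt with h0 | h0
    · rw [← h0]; positivity
    · have h6 : ‖P (y - b)‖ ≤ C * ‖a - b‖ * ‖y - b‖ := by
        refine le_of_mul_le_mul_left ?_ h0
        linarith
      have h7 : C * ‖a - b‖ * ‖y - b‖ ≤ C * ‖a - b‖ * ε := by gcongr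
      nlinarith [norm_nonneg (a - b)]
  have h4 : ‖P (a - b)‖ ≤ ‖a - b‖ := Submodule.norm_starProjection_apply_le _ _
  have h5 : ‖P (x - y)‖ ≤ ‖P (a - b)‖ + ‖P (y - b)‖ := by rw [h2]; exact _root_.norm_sub_le _ _
  linarith

/-- The inverse of a continuous bijection from a compact set is continuous. -/
theorem continuousOn_of_leftInvOn {X Y : Type*} [TopologicalSpace X] [TopologicalSpace Y]
    [T2Space Y] {s : Set X} {t : Set Y} (hs : IsCompact s) {p : X → Y} {q : Y → X}
    (hp : ContinuousOn p s) (hq : InvOn q p s t) (hqm : MapsTo q t s) :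
    ContinuousOn q t := by
  rw [continuousOn_iff_isClosed]
  intro u hu
  refine ⟨p '' (s ∩ u), ((hs.inter_right hu).image_of_continuousOn
    (hp.mono inter_subset_left)).isClosed, ?_⟩
  ext y
  constructor
  · rintro ⟨h1, h2⟩
    exact ⟨⟨q y, ⟨hqm h2, h1⟩, hq.2 h2⟩, h2⟩
  · rintro ⟨⟨x, ⟨hxs, hxu⟩, rfl⟩, h2⟩
    refine ⟨?_, h2⟩
    rw [mem_preimage, hq.1 hxs]
    exact hxu

theorem measurableSet_inter_preimage {X Y : Type*} [TopologicalSpace X] [MeasurableSpace X]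
    [OpensMeasurableSpace X] [TopologicalSpace Y] {B : Set X} (hB : IsOpen B) {θ : X → Y}
    (hθ : ContinuousOn θ B) {K : Set Y} (hK : IsClosed K) : MeasurableSet (B ∩ θ ⁻¹' K) := by
  have h : B ∩ θ ⁻¹' K = B \ (B ∩ θ ⁻¹' Kᶜ) := by
    ext x
    simp only [mem_inter_iff, mem_preimage, Set.mem_sdiff, mem_compl_iff]
    tauto
  rw [h]
  exact hB.measurableSet.diff (hθ.isOpen_inter_preimage hB hK.isOpen_compl).measurableSet

/-- The discrete manifolds have bi-Lipschitz parametrizations with uniform size and constants. -/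
theorem exists_isLipChart_discrete {Γ : Set (𝔼 k)} (hΓ : IsSmoothSubmanifold d c Γ)
    (hΓc : IsCompact Γ) (hne : Γ.Nonempty) {δ Cρ CP : ℝ} (hCρ : 0 < Cρ) (hCP : 0 < CP) :
    ∃ r > 0, ∃ L ≥ 1, ∃ h₀ > 0, ∀ h, 0 < h → h ≤ h₀ → ∀ 𝒦 : Mesh d k,
      IsDiscreteManifold Γ δ Cρ CP h 𝒦 →
      ∀ a ∈ Γ, ∃ θ : (𝔼 d) → 𝔼 k, IsLipChart 𝒦.carrier (closestPoint Γ) r L a θ := by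
  obtain ⟨C₁, hC₁, hreach⟩ := exists_inner_normal_le hΓ hΓc
  obtain ⟨C₂, hC₂, htan⟩ := exists_inner_tangent_normal_le hΓ hΓc
  obtain ⟨r, hr, L, hL, hchart⟩ := exists_isLipChart hΓ hΓc
  refine ⟨r, hr, 4 * L, by linarith, min (min 1 (1 / (2 * CP)))
    (min (1 / (4 * (Cρ * C₁))) (1 / (Cρ * C₂))), by positivity, ?_⟩
  intro h hh hh₀ 𝒦 h𝒦
  have hh1 : h ≤ 1 := hh₀.trans ((min_le_left _ _).trans (min_le_left _ _))
  have hh2 : CP * h ≤ 1 / 2 := by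
    have : h ≤ 1 / (2 * CP) := hh₀.trans ((min_le_left _ _).trans (min_le_right _ _))
    rw [le_div_iff₀ (by positivity)] at this
    linarith
  have hsq : h ^ 2 ≤ h := by nlinarith
  have hε₁ : Cρ * h ^ 2 * C₁ ≤ 1 / 4 := by
    have : h ≤ 1 / (4 * (Cρ * C₁)) := hh₀.trans ((min_le_right _ _).trans (min_le_left _ _))
    rw [le_div_iff₀ (by positivity)] at this
    have h2 : h ^ 2 * (Cρ * C₁) ≤ h * (Cρ * C₁) := by gcongr
    linarith
  have hε₂ : Cρ * h ^ 2 * C₂ ≤ 1 := by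
    have : h ≤ 1 / (Cρ * C₂) := hh₀.trans ((min_le_right _ _).trans (min_le_right _ _))
    rw [le_div_iff₀ (by positivity)] at this
    have h2 : h ^ 2 * (Cρ * C₂) ≤ h * (Cρ * C₂) := by gcongr
    linarith
  have hcl : ∀ x, IsClosestPoint Γ x (closestPoint Γ x) := isClosestPoint_closestPoint hΓc hne
  have hplip : ∀ x ∈ 𝒦.carrier, ∀ y ∈ 𝒦.carrier,
      ‖closestPoint Γ x - closestPoint Γ y‖ ≤ 2 * ‖x - y‖ := fun x hx y hy =>
    (hcl x).norm_sub_le hC₁ hreach hε₁ (hcl y) (h𝒦.infDist_le x hx) (h𝒦.infDist_le y hy)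
  intro a ha
  obtain ⟨ψ, hψ⟩ := hchart a ha
  set p := closestPoint Γ with hp
  set q := Function.invFunOn p 𝒦.carrier with hq
  have hinv : InvOn q p 𝒦.carrier Γ := h𝒦.bijOn.invOn_invFunOn
  have hqm : MapsTo q Γ 𝒦.carrier := h𝒦.bijOn.surjOn.mapsTo_invFunOn
  have hpc : ContinuousOn p 𝒦.carrier := by
    have : LipschitzOnWith 2 p 𝒦.carrier := LipschitzOnWith.of_dist_le_mul fun x hx y hy => by
      simpa [dist_eq_norm] using hplip x hx y hy
    exact this.continuousOn
  have hqc : ContinuousOn q Γ := continuousOn_of_leftInvOn 𝒦.isCompact_carrier hpc hinv hqm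
  have hψc : ContinuousOn ψ (Metric.ball 0 r) := by
    have : LipschitzOnWith L.toNNReal ψ (Metric.ball 0 r) :=
      LipschitzOnWith.of_dist_le_mul fun x hx y hy => by
        rw [Real.coe_toNNReal L (by linarith), dist_eq_norm, dist_eq_norm]
        exact hψ.norm_sub_le x hx y hy
    exact this.continuousOn
  set θ : (𝔼 d) → 𝔼 k := fun u => q (ψ u) with hθ
  have hθc : ContinuousOn θ (Metric.ball 0 r) := hqc.comp hψc hψ.mapsTo
  have hpθ : ∀ u ∈ Metric.ball 0 r, p (θ u) = ψ u := fun u hu => hinv.2 (hψ.mapsTo u hu)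
  have hθm : ∀ u ∈ Metric.ball 0 r, θ u ∈ 𝒦.carrier := fun u hu => hqm (hψ.mapsTo u hu)
  have hcell : ∀ s ∈ 𝒦.cells, ∀ x ∈ simplex s, ∀ y ∈ simplex s, ‖x - y‖ ≤ 4 * ‖p x - p y‖ := by
    intro s hs x hx y hy
    refine (hcl x).norm_sub_ge hC₂ htan hε₂ (hcl y)
      (h𝒦.infDist_le y (𝒦.simplex_subset_carrier hs hy)) ?_
      ((h𝒦.projection_le s hs x hx).trans hh2)
    exact vsub_mem_vectorSpan ℝ hx hy
  have hlip : LipschitzOnWith (4 * L).toNNReal θ (Metric.ball 0 r) := by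
    refine lipschitzOnWith_of_cover (convex_ball _ _) hθc 𝒦.cells
      (fun s => Metric.ball 0 r ∩ θ ⁻¹' simplex s) (fun s _ => measurableSet_inter_preimage
        Metric.isOpen_ball hθc (isCompact_simplex s).isClosed) ?_ _ ?_
    · intro u hu
      obtain ⟨s, hs, hus⟩ := mem_iUnion₂.1 (hθm u hu)
      exact mem_iUnion₂.2 ⟨s, hs, hu, hus⟩
    · intro s hs
      refine LipschitzOnWith.of_dist_le_mul fun u hu u' hu' => ?_
      rw [Real.coe_toNNReal _ (by linarith), dist_eq_norm, dist_eq_norm]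
      have h1 := hcell s hs _ hu.1.2 _ hu'.1.2
      rw [hpθ u hu.2, hpθ u' hu'.2] at h1
      have h2 := hψ.norm_sub_le u hu.2 u' hu'.2
      linarith
  refine ⟨θ, fun u hu => ?_, hθm, ?_, ?_, ?_⟩
  · rw [hpθ u hu]
    refine (hψ.dist_le u hu).trans ?_
    gcongr
    linarith
  · intro u hu u' hu'
    have := hlip.dist_le_mul u hu u' hu'
    rwa [Real.coe_toNNReal _ (by linarith), dist_eq_norm, dist_eq_norm] at this
  · intro u hu u' hu'
    have h1 := hplip _ (hθm u hu) _ (hθm u' hu')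
    rw [hpθ u hu, hpθ u' hu'] at h1
    have h2 := hψ.le_norm_sub u hu u' hu'
    calc ‖u - u'‖ ≤ L * (2 * ‖θ u - θ u'‖) := h2.trans (by gcongr)
      _ ≤ 4 * L * ‖θ u - θ u'‖ := by nlinarith [norm_nonneg (θ u - θ u')]
  · intro b hb hba
    obtain ⟨u, hu, hub⟩ := hψ.mem_image (p b) (h𝒦.bijOn.mapsTo hb) (by
      refine lt_of_lt_of_le hba ?_
      gcongr
      linarith)
    refine ⟨u, hu, ?_⟩
    simp only [hθ]
    rw [hub]
    exact hinv.1 hb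

/-! ### Gradients of piecewise affine functions -/

theorem gradientWithin_eq_of_affine {V : Type*} [NormedAddCommGroup V] [InnerProductSpace ℝ V]
    [CompleteSpace V] {f : V → ℝ} {s : Set V} {x : V} (ℓ : V →L[ℝ] ℝ) (b : ℝ)
    (hf : EqOn f (fun y => ℓ y + b) s) (hx : x ∈ s) (hs : UniqueDiffWithinAt ℝ s x) :
    ‖gradientWithin f s x‖ = ‖ℓ‖ := by
  have h : HasFDerivWithinAt f ℓ s x :=
    (ℓ.hasFDerivWithinAt.add_const b).congr hf (hf hx)
  rw [gradientWithin, h.fderivWithin hs, LinearIsometryEquiv.norm_map]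

theorem exists_norm_gradientWithin_eq {S : Set (𝔼 k)} (hS : Convex ℝ S)
    (hint : (interior S).Nonempty) {v : (𝔼 k) → ℝ} (A : (𝔼 k) →ᵃ[ℝ] ℝ) (hv : EqOn v A S) :
    ∃ ℓ : ℝ≥0, (∀ x ∈ S, ‖gradientWithin v S x‖ = ℓ) ∧ LipschitzOnWith ℓ v S := by
  set ℓ : (𝔼 k) →L[ℝ] ℝ := LinearMap.toContinuousLinearMap A.linear with hℓ
  refine ⟨‖ℓ‖₊, fun x hx => ?_, ?_⟩
  · refine gradientWithin_eq_of_affine ℓ (A 0) (fun y hy => ?_) hx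
      (uniqueDiffOn_convex hS hint x hx)
    rw [hv hy]
    simpa [hℓ] using congrFun A.decomp y
  · refine LipschitzOnWith.of_dist_le_mul fun x hx y hy => ?_
    rw [hv hx, hv hy, dist_eq_norm, dist_eq_norm, ← vsub_eq_sub (A x), ← A.linearMap_vsub]
    exact ℓ.le_opNorm _

theorem uniqueDiffWithinAt_vectorSpan {S : Set (𝔼 k)} (hS : Convex ℝ S) {x : 𝔼 k} (hx : x ∈ S) :
    UniqueDiffWithinAt ℝ {w : vectorSpan ℝ S | x + (w : 𝔼 k) ∈ S} 0 := by
  set s := {w : vectorSpan ℝ S | x + (w : 𝔼 k) ∈ S} with hs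
  have h0 : (0 : vectorSpan ℝ S) ∈ s := by simpa [hs] using hx
  have hconv : Convex ℝ s := by
    intro w hw w' hw' a b ha hb hab
    have := hS hw hw' ha hb hab
    simp only [hs, mem_ofPred_eq, Submodule.coe_add, Submodule.coe_smul] at this ⊢
    convert this using 1
    rw [smul_add, smul_add, add_add_add_comm, ← add_smul, hab, one_smul]
  refine ⟨?_, subset_closure h0⟩
  have htop : Submodule.span ℝ (tangentConeAt ℝ s 0) = ⊤ := by
    rw [eq_top_iff]
    have h1 : s ⊆ tangentConeAt ℝ s 0 := fun w hw => by
      have := mem_tangentConeAt_of_segment_subset (hconv.segment_subset h0 hw)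
      rwa [sub_zero] at this
    refine le_trans ?_ (Submodule.span_mono h1)
    rintro ⟨w, hw⟩ -
    have h2 : vectorSpan ℝ S ≤ (Submodule.span ℝ s).map (vectorSpan ℝ S).subtype := by
      conv_lhs => rw [vectorSpan_eq_span_vsub_set_right ℝ hx]
      refine Submodule.span_le.2 ?_
      rintro _ ⟨y, hy, rfl⟩
      refine ⟨⟨y - x, vsub_mem_vectorSpan ℝ hy hx⟩, Submodule.subset_span ?_, rfl⟩
      simpa [hs] using hy
    obtain ⟨w', hw', hww⟩ := h2 hw
    have : w' = ⟨w, hw⟩ := Subtype.ext hww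
    rwa [← this]
  rw [htop]
  exact dense_univ

theorem exists_norm_tangentialGradient_eq {S : Set (𝔼 k)} (hS : Convex ℝ S) {v : (𝔼 k) → ℝ}
    (A : (𝔼 k) →ᵃ[ℝ] ℝ) (hv : EqOn v A S) :
    ∃ ℓ : ℝ≥0, (∀ x ∈ S, ‖tangentialGradient v S x‖ = ℓ) ∧ LipschitzOnWith ℓ v S := by
  set ℓ : vectorSpan ℝ S →L[ℝ] ℝ :=
    (LinearMap.toContinuousLinearMap A.linear).comp (vectorSpan ℝ S).subtypeL with hℓ
  refine ⟨‖ℓ‖₊, fun x hx => ?_, ?_⟩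
  · refine gradientWithin_eq_of_affine ℓ (A x) (fun w hw => ?_) (by simpa using hx)
      (uniqueDiffWithinAt_vectorSpan hS hx)
    have h1 : v (x + w) = A (x + w) := hv hw
    have h2 : A (x + w) = A.linear w + A x := by
      have := A.map_vadd x (w : 𝔼 k)
      rwa [vadd_eq_add, vadd_eq_add, add_comm (w : 𝔼 k)] at this
    simp only [h1, h2]
    rfl
  · refine LipschitzOnWith.of_dist_le_mul fun x hx y hy => ?_
    rw [hv hx, hv hy, dist_eq_norm, dist_eq_norm, ← vsub_eq_sub (A x), ← A.linearMap_vsub]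
    exact ℓ.le_opNorm ⟨x - y, vsub_mem_vectorSpan ℝ hx hy⟩

/-! ### Counting cells -/

theorem volume_convexHull_eq_zero {u : Finset (𝔼 k)} (hu : u.card ≤ k) :
    volume (convexHull ℝ (u : Set (𝔼 k))) = 0 := by
  classical
  rcases Nat.eq_zero_or_pos u.card with h0 | h0
  · rw [Finset.card_eq_zero] at h0
    simp [h0]
  obtain ⟨n, hn⟩ : ∃ n, u.card = n + 1 := ⟨u.card - 1, by omega⟩
  refine measure_mono_null (convexHull_subset_affineSpan _)
    (Measure.addHaar_affineSubspace volume _ fun htop => ?_)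
  have h1 := finrank_vectorSpan_image_finset_le ℝ (id : (𝔼 k) → 𝔼 k) u hn
  rw [Finset.image_id, ← direction_affineSpan, htop, AffineSubspace.direction_top, finrank_top,
    finrank_euclideanSpace_fin] at h1
  omega

theorem Mesh.volume_inter_eq_zero (M : Mesh k k) {s t : Finset (𝔼 k)} (hs : s ∈ M.cells)
    (ht : t ∈ M.cells) (hst : s ≠ t) : volume (simplex s ∩ simplex t) = 0 := by
  classical
  rw [M.conforming s hs t ht, ← Finset.coe_inter]
  refine volume_convexHull_eq_zero ?_
  have h1 := M.card_cell s hs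
  have h2 := M.card_cell t ht
  have h3 : s ∩ t ⊂ s := by
    refine Finset.ssubset_iff_subset_ne.2 ⟨Finset.inter_subset_left, fun h => hst ?_⟩
    exact Finset.eq_of_subset_of_card_le (Finset.inter_eq_left.1 h) (by omega)
  have := Finset.card_lt_card h3
  omega

theorem Mesh.QuasiUniform.le_volume_real {M : Mesh k k} {h σ : ℝ} (hM : M.QuasiUniform h σ)
    (hh : 0 < h) (hσ : 0 < σ) {t : Finset (𝔼 k)} (ht : t ∈ M.cells) :
    (h / σ) ^ k * volume.real (Metric.ball (0 : 𝔼 k) 1) ≤ volume.real (simplex t) := by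
  obtain ⟨z, hz⟩ := (hM t ht).2
  have h1 := Measure.addHaar_real_closedBall (volume : Measure (𝔼 k)) z
    (r := h / σ) (by positivity)
  rw [finrank_euclideanSpace_fin] at h1
  rw [← h1]
  exact measureReal_mono hz (isCompact_simplex t).measure_lt_top.ne

theorem Mesh.QuasiUniform.interior_nonempty {M : Mesh k k} {h σ : ℝ} (hM : M.QuasiUniform h σ)
    (hh : 0 < h) (hσ : 0 < σ) {t : Finset (𝔼 k)} (ht : t ∈ M.cells) :
    (interior (simplex t)).Nonempty := by
  obtain ⟨z, hz⟩ := (hM t ht).2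
  exact ⟨z, interior_mono hz (Metric.ball_subset_interior_closedBall (Metric.mem_ball_self
    (by positivity)))⟩

theorem Mesh.QuasiUniform.dist_le {M : Mesh k k} {h σ : ℝ} (hM : M.QuasiUniform h σ)
    {t : Finset (𝔼 k)} (ht : t ∈ M.cells) {x y : 𝔼 k} (hx : x ∈ simplex t) (hy : y ∈ simplex t) :
    dist x y ≤ σ * h :=
  (Metric.dist_le_diam_of_mem (isCompact_simplex t).isBounded hx hy).trans (hM t ht).1

/-- The number of cells of a quasi-uniform mesh in a ball of radius comparable to the mesh size is
bounded. -/
theorem Mesh.QuasiUniform.card_le {M : Mesh k k} {h σ : ℝ} (hM : M.QuasiUniform h σ)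
    (hh : 0 < h) (hσ : 0 < σ) {R : ℝ} (hR : 0 ≤ R) (z : 𝔼 k) (I : Finset (Finset (𝔼 k)))
    (hI : I ⊆ M.cells) (hIz : ∀ t ∈ I, simplex t ⊆ Metric.closedBall z (R * h)) :
    (I.card : ℝ) ≤ (R * σ) ^ k := by
  set β := volume.real (Metric.ball (0 : 𝔼 k) 1) with hβ
  have hβ0 : 0 < β := ENNReal.toReal_pos (Metric.measure_ball_pos volume _ one_pos).ne'
    measure_ball_lt_top.ne
  have h1 : volume (⋃ t ∈ I, simplex t) = ∑ t ∈ I, volume (simplex t) :=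
    measure_biUnion_finset₀ (fun s hs t ht hst => M.volume_inter_eq_zero (hI hs) (hI ht) hst)
      fun t _ => (isCompact_simplex t).measurableSet.nullMeasurableSet
  have h2 : ∑ t ∈ I, volume.real (simplex t) ≤ volume.real (Metric.closedBall z (R * h)) := by
    have h3 : volume.real (⋃ t ∈ I, simplex t) = ∑ t ∈ I, volume.real (simplex t) := by
      rw [measureReal_def, h1, ENNReal.toReal_sum
        fun t _ => (isCompact_simplex t).measure_lt_top.ne]
      rfl
    rw [← h3]
    exact measureReal_mono (iUnion₂_subset hIz) measure_closedBall_lt_top.ne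
  have h4 : (I.card : ℝ) * ((h / σ) ^ k * β) ≤ ∑ t ∈ I, volume.real (simplex t) := by
    rw [← nsmul_eq_mul]
    exact Finset.card_nsmul_le_sum _ _ _ fun t ht => hM.le_volume_real hh hσ (hI ht)
  have h5 := Measure.addHaar_real_closedBall (volume : Measure (𝔼 k)) z
    (r := R * h) (by positivity)
  rw [finrank_euclideanSpace_fin] at h5
  rw [h5] at h2
  have h6 : (I.card : ℝ) * ((h / σ) ^ k * β) ≤ (R * σ) ^ k * ((h / σ) ^ k * β) := by
    refine (h4.trans h2).trans (le_of_eq ?_)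
    rw [← mul_assoc, ← mul_pow]
    congr 2
    field_simp
  exact le_of_mul_le_mul_right h6 (by positivity)

/-! ### The active mesh -/

theorem mem_activeCells {𝒯 : Mesh k k} {S : Set (𝔼 k)} {t : Finset (𝔼 k)} :
    t ∈ activeCells 𝒯 S ↔ t ∈ 𝒯.cells ∧ (simplex t ∩ S).Nonempty := by
  classical
  simp [activeCells]

theorem exists_activeCell {𝒯 : Mesh k k} {S : Set (𝔼 k)} (hS : S ⊆ 𝒯.carrier) {x : 𝔼 k}
    (hx : x ∈ S) : ∃ t ∈ activeCells 𝒯 S, x ∈ simplex t := by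
  obtain ⟨t, ht, hxt⟩ := mem_iUnion₂.1 (hS hx)
  exact ⟨t, mem_activeCells.2 ⟨ht, x, hxt, hx⟩, hxt⟩

theorem IsBackgroundMesh.carrier_subset {Γ Ω : Set (𝔼 k)} {δ σ h Cρ CP : ℝ} {𝒯 : Mesh k k}
    {𝒦 : Mesh d k} (h𝒯 : IsBackgroundMesh Γ δ σ h Ω 𝒯) (h𝒦 : IsDiscreteManifold Γ δ Cρ CP h 𝒦) :
    𝒦.carrier ⊆ 𝒯.carrier := by
  rw [h𝒯.carrier_eq]
  exact (h𝒦.subset_thickening.trans h𝒯.thickening_subset).trans subset_closure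

theorem Mesh.simplex_nonempty {m : ℕ} (M : Mesh m k) {s : Finset (𝔼 k)} (hs : s ∈ M.cells) :
    (simplex s).Nonempty := by
  have : s.Nonempty := Finset.card_pos.1 (by rw [M.card_cell s hs]; omega)
  exact convexHull_nonempty_iff.2 this

theorem Compatible.exists_subset {𝒯 : Mesh k k} {𝒦 : Mesh d k} (hcomp : Compatible 𝒯 𝒦)
    (hsub : 𝒦.carrier ⊆ 𝒯.carrier) {s : Finset (𝔼 k)} (hs : s ∈ 𝒦.cells) :
    ∃ t ∈ activeCells 𝒯 𝒦.carrier, simplex s ⊆ simplex t := by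
  obtain ⟨z, hz⟩ := (𝒦.simplex_nonempty hs).intrinsicInterior (convex_simplex s)
  obtain ⟨t, ht, hzt⟩ := exists_activeCell hsub
    (𝒦.simplex_subset_carrier hs (intrinsicInterior_subset hz))
  exact ⟨t, ht, hcomp s hs t ht ⟨z, hz, hzt⟩⟩

/-- The norm of the gradient on each active cell, as a function of the cell. -/
theorem exists_cellGradient {𝒯 : Mesh k k} {S : Set (𝔼 k)} {h σ : ℝ} (hM : 𝒯.QuasiUniform h σ)
    (hh : 0 < h) (hσ : 0 < σ) {v : (𝔼 k) → ℝ} (hv : IsDiscreteFunction 𝒯 S v) :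
    ∃ ℓ : Finset (𝔼 k) → ℝ≥0, ∀ t ∈ activeCells 𝒯 S,
      (∀ x ∈ simplex t, ‖gradientWithin v (simplex t) x‖ = ℓ t) ∧
        LipschitzOnWith (ℓ t) v (simplex t) := by
  have h1 : ∀ t, ∃ ℓ : ℝ≥0, t ∈ activeCells 𝒯 S →
      (∀ x ∈ simplex t, ‖gradientWithin v (simplex t) x‖ = ℓ) ∧
        LipschitzOnWith ℓ v (simplex t) := by
    intro t
    by_cases ht : t ∈ activeCells 𝒯 S
    · obtain ⟨A, hA⟩ := hv.2 t ht
      obtain ⟨ℓ, hℓ⟩ := exists_norm_gradientWithin_eq (convex_simplex t)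
        (hM.interior_nonempty hh hσ (mem_activeCells.1 ht).1) A hA
      exact ⟨ℓ, fun _ => hℓ⟩
    · exact ⟨0, fun h => absurd h ht⟩
  choose ℓ hℓ using h1
  exact ⟨ℓ, hℓ⟩

theorem exists_cellTangentialGradient {𝒯 : Mesh k k} {𝒦 : Mesh d k} (hcomp : Compatible 𝒯 𝒦)
    (hsub : 𝒦.carrier ⊆ 𝒯.carrier) {v : (𝔼 k) → ℝ} (hv : IsDiscreteFunction 𝒯 𝒦.carrier v) :
    ∃ ℓ : Finset (𝔼 k) → ℝ≥0, ∀ s ∈ 𝒦.cells,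
      (∀ x ∈ simplex s, ‖tangentialGradient v (simplex s) x‖ = ℓ s) ∧
        LipschitzOnWith (ℓ s) v (simplex s) := by
  have h1 : ∀ s, ∃ ℓ : ℝ≥0, s ∈ 𝒦.cells →
      (∀ x ∈ simplex s, ‖tangentialGradient v (simplex s) x‖ = ℓ) ∧
        LipschitzOnWith ℓ v (simplex s) := by
    intro s
    by_cases hs : s ∈ 𝒦.cells
    · obtain ⟨t, ht, hst⟩ := hcomp.exists_subset hsub hs
      obtain ⟨A, hA⟩ := hv.2 t ht
      obtain ⟨ℓ, hℓ⟩ := exists_norm_tangentialGradient_eq (convex_simplex s) A (hA.mono hst)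
      exact ⟨ℓ, fun _ => hℓ⟩
    · exact ⟨0, fun h => absurd h hs⟩
  choose ℓ hℓ using h1
  exact ⟨ℓ, hℓ⟩

theorem euclideanHausdorffMeasure_image_le {X Y : Type*} [EMetricSpace X] [MeasurableSpace X]
    [BorelSpace X] [EMetricSpace Y] [MeasurableSpace Y] [BorelSpace Y] {K : ℝ≥0} {f : X → Y}
    {s : Set X} (h : LipschitzOnWith K f s) (d : ℕ) :
    μHE[d] (f '' s) ≤ (K : ℝ≥0∞) ^ d * μHE[d] s := by
  have h1 := h.hausdorffMeasure_image_le (d := d) (by positivity)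
  rw [ENNReal.rpow_natCast] at h1
  simp only [Measure.euclideanHausdorffMeasure_def, Measure.smul_apply, ENNReal.smul_def,
    smul_eq_mul]
  rw [mul_left_comm]
  gcongr

namespace IsLipChart

variable {M : Set (𝔼 k)} {π : (𝔼 k) → 𝔼 k} {r : ℝ} {K : ℝ≥0} {a : 𝔼 k} {θ : (𝔼 d) → 𝔼 k}

theorem lipschitzOnWith (h : IsLipChart M π r K a θ) :
    LipschitzOnWith K θ (Metric.ball 0 r) :=
  LipschitzOnWith.of_dist_le_mul fun u hu u' hu' => by
    rw [dist_eq_norm, dist_eq_norm]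
    exact h.norm_sub_le u hu u' hu'

theorem measure_image_le (h : IsLipChart M π r K a θ) {A : Set (𝔼 d)}
    (hA : A ⊆ Metric.ball 0 r) : μHE[d] (θ '' A) ≤ (K : ℝ≥0∞) ^ d * volume A := by
  rw [← EuclideanSpace.euclideanHausdorffMeasure_eq_volume]
  exact euclideanHausdorffMeasure_image_le (h.lipschitzOnWith.mono hA) d

theorem le_measure_image (h : IsLipChart M π r K a θ) {A : Set (𝔼 d)}
    (hA : A ⊆ Metric.ball 0 r) : volume A ≤ (K : ℝ≥0∞) ^ d * μHE[d] (θ '' A) := by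
  have hinj : InjOn θ (Metric.ball 0 r) := fun u hu u' hu' huu => by
    have := h.le_norm_sub u hu u' hu'
    rw [huu, sub_self, norm_zero, mul_zero] at this
    exact sub_eq_zero.1 (norm_le_zero_iff.1 this)
  have hinv : LeftInvOn (Function.invFunOn θ (Metric.ball 0 r)) θ (Metric.ball 0 r) :=
    hinj.leftInvOn_invFunOn
  have hlip : LipschitzOnWith K (Function.invFunOn θ (Metric.ball 0 r)) (θ '' A) := by
    refine LipschitzOnWith.of_dist_le_mul ?_
    rintro _ ⟨u, hu, rfl⟩ _ ⟨u', hu', rfl⟩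
    rw [hinv (hA hu), hinv (hA hu'), dist_eq_norm, dist_eq_norm]
    exact h.le_norm_sub u (hA hu) u' (hA hu')
  have h1 := euclideanHausdorffMeasure_image_le hlip d
  rwa [(hinv.mono hA).image_image, EuclideanSpace.euclideanHausdorffMeasure_eq_volume] at h1

theorem aemeasurable (h : IsLipChart M π r K a θ) :
    AEMeasurable θ (volume.restrict (Metric.ball 0 r)) :=
  h.lipschitzOnWith.continuousOn.aemeasurable measurableSet_ball

theorem restrict_image_le (h : IsLipChart M π r K a θ) :
    (μHE[d] : Measure (𝔼 k)).restrict (θ '' Metric.ball 0 r) ≤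
      (K : ℝ≥0∞) ^ d • (volume.restrict (Metric.ball 0 r)).map θ := by
  refine Measure.le_iff.2 fun A hA => ?_
  rw [Measure.restrict_apply hA, Measure.smul_apply, smul_eq_mul,
    Measure.map_apply_of_aemeasurable h.aemeasurable hA, inter_comm, ← image_inter_preimage]
  refine (h.measure_image_le inter_subset_left).trans (mul_le_mul_right ?_ _)
  rw [inter_comm]
  exact Measure.le_restrict_apply _ _

theorem lintegral_image_le (h : IsLipChart M π r K a θ) {g : (𝔼 k) → ℝ≥0∞} (hg : Measurable g) :
    ∫⁻ x in θ '' Metric.ball 0 r, g x ∂μHE[d] ≤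
      (K : ℝ≥0∞) ^ d * ∫⁻ u in Metric.ball 0 r, g (θ u) := by
  refine (lintegral_mono' h.restrict_image_le le_rfl).trans ?_
  rw [lintegral_smul_measure, lintegral_map' hg.aemeasurable h.aemeasurable, smul_eq_mul]

theorem pairEnergy_image_le (h : IsLipChart M π r K a θ) {f : (𝔼 k) → ℝ} (hf : Measurable f)
    [SFinite ((μHE[d] : Measure (𝔼 k)).restrict (θ '' Metric.ball 0 r))] :
    pairEnergy μHE[d] f (θ '' Metric.ball 0 r) (θ '' Metric.ball 0 r) ≤
      (K : ℝ≥0∞) ^ d * ((K : ℝ≥0∞) ^ d * ∫⁻ u in Metric.ball 0 r, ∫⁻ u' in Metric.ball 0 r,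
        ENNReal.ofReal ((f (θ u) - f (θ u')) ^ 2)) := by
  have hm := measurable_ofReal_sq_sub hf
  have h1 : Measurable fun x => ∫⁻ y in θ '' Metric.ball 0 r,
      ENNReal.ofReal ((f x - f y) ^ 2) ∂μHE[d] := hm.lintegral_prod_right'
  refine (h.lintegral_image_le h1).trans ?_
  gcongr
  rw [← lintegral_const_mul' _ _ (by finiteness)]
  refine lintegral_mono fun u => ?_
  exact h.lintegral_image_le ((measurable_const.sub hf).pow_const 2).ennreal_ofReal

end IsLipChart

/-- A discrete manifold over `Γ` with uniform charts. -/
structure HasLipCharts (Γ : Set (𝔼 k)) (π : (𝔼 k) → 𝔼 k) (r : ℝ) (K : ℝ≥0) (𝒦 : Mesh d k) :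
    Prop where
  mapsTo : MapsTo π 𝒦.carrier Γ
  exists_chart : ∀ a ∈ Γ, ∃ θ : (𝔼 d) → 𝔼 k, IsLipChart 𝒦.carrier π r K a θ

section Surface

variable {Γ : Set (𝔼 k)} {π : (𝔼 k) → 𝔼 k} {r : ℝ} {K : ℝ≥0}

theorem inter_carrier_subset_image {𝒦 : Mesh d k} {a : 𝔼 k} {θ : (𝔼 d) → 𝔼 k}
    (h : IsLipChart 𝒦.carrier π r K a θ) :
    π ⁻¹' Metric.ball a (r / K) ∩ 𝒦.carrier ⊆ θ '' Metric.ball 0 r := fun x hx =>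
  h.mem_image x hx.2 hx.1

theorem exists_surface_measure_le (hΓ : IsCompact Γ) (hr : 0 < r) (hK : 0 < K) :
    ∃ M : ℝ≥0, ∀ 𝒦 : Mesh d k, HasLipCharts Γ π r K 𝒦 → μHE[d] 𝒦.carrier ≤ M := by
  obtain ⟨M, hM⟩ := exists_measure_preimage_le (κ := {𝒦 : Mesh d k // HasLipCharts Γ π r K 𝒦}) hΓ
    (fun i => (μHE[d] : Measure (𝔼 k)).restrict i.1.carrier) (fun _ => π) (fun a ha => by
      refine ⟨r / K, by positivity, ((K : ℝ≥0∞) ^ d * volume (Metric.ball (0 : 𝔼 d) r)).toNNReal,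
        fun i => ?_⟩
      obtain ⟨θ, hθ⟩ := i.2.exists_chart a ha
      rw [ENNReal.coe_toNNReal (ENNReal.mul_ne_top (by finiteness) measure_ball_lt_top.ne),
        Measure.restrict_apply' i.1.isCompact_carrier.measurableSet]
      exact (measure_mono (inter_carrier_subset_image hθ)).trans (hθ.measure_image_le subset_rfl))
  refine ⟨M, fun 𝒦 h𝒦 => ?_⟩
  refine le_trans ?_ (hM ⟨𝒦, h𝒦⟩)
  rw [Measure.restrict_apply' 𝒦.isCompact_carrier.measurableSet]
  exact measure_mono fun x hx => ⟨h𝒦.mapsTo hx, hx⟩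

theorem exists_le_surface_measure (hr : 0 < r) (hK : 0 < K) {a : 𝔼 k} (ha : a ∈ Γ) {s : ℝ}
    (hs : 0 < s) :
    ∃ m : ℝ≥0, 0 < m ∧ ∀ 𝒦 : Mesh d k, HasLipCharts Γ π r K 𝒦 →
      m ≤ (μHE[d] : Measure (𝔼 k)).restrict 𝒦.carrier (π ⁻¹' Metric.ball a s) := by
  set ρ := min r (s / K) with hρ
  have hρ0 : 0 < ρ := lt_min hr (by positivity)
  have hv : volume (Metric.ball (0 : 𝔼 d) ρ) ≠ ⊤ := measure_ball_lt_top.ne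
  have hv0 : volume (Metric.ball (0 : 𝔼 d) ρ) ≠ 0 := (Metric.measure_ball_pos _ _ hρ0).ne'
  have hKd : (K : ℝ≥0∞) ^ d ≠ 0 := pow_ne_zero _ (by simpa using hK.ne')
  refine ⟨(volume (Metric.ball (0 : 𝔼 d) ρ) / (K : ℝ≥0∞) ^ d).toNNReal, ?_, fun 𝒦 h𝒦 => ?_⟩
  · refine ENNReal.toNNReal_pos ?_ (ENNReal.div_ne_top hv hKd)
    exact (ENNReal.div_pos hv0 (by finiteness)).ne'
  · obtain ⟨θ, hθ⟩ := h𝒦.exists_chart a ha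
    rw [ENNReal.coe_toNNReal (ENNReal.div_ne_top hv hKd),
      Measure.restrict_apply' 𝒦.isCompact_carrier.measurableSet]
    refine ENNReal.div_le_of_le_mul' ?_
    have hsub := Metric.ball_subset_ball (x := (0 : 𝔼 d)) (min_le_left r (s / K))
    refine (hθ.le_measure_image hsub).trans ?_
    gcongr
    rintro _ ⟨u, hu, rfl⟩
    refine ⟨?_, hθ.mapsTo u (hsub hu)⟩
    rw [mem_preimage, Metric.mem_ball]
    refine (hθ.dist_le u (hsub hu)).trans_lt ?_
    rw [mem_ball_zero_iff] at hu
    have := hu.trans_le (min_le_right r (s / K))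
    rwa [lt_div_iff₀ (by exact_mod_cast hK), mul_comm] at this

/-- The local Poincaré inequality on a discrete manifold. -/
theorem exists_local_pairEnergy_le (r : ℝ) (hr : 0 < r) (K : ℝ≥0) :
    ∃ C : ℝ≥0, ∀ (Γ : Set (𝔼 k)) (π : (𝔼 k) → 𝔼 k) (𝒦 : Mesh d k), ∀ a ∈ Γ,
      HasLipCharts Γ π r K 𝒦 → ∀ (f : (𝔼 k) → ℝ) (ℓ : Finset (𝔼 k) → ℝ≥0),
      Measurable f → ContinuousOn f 𝒦.carrier →
      (∀ s ∈ 𝒦.cells, LipschitzOnWith (ℓ s) f (simplex s)) →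
      pairEnergy ((μHE[d] : Measure (𝔼 k)).restrict 𝒦.carrier) f (π ⁻¹' Metric.ball a (r / K))
        (π ⁻¹' Metric.ball a (r / K)) ≤
        C * ∑ s ∈ 𝒦.cells, (ℓ s : ℝ≥0∞) ^ 2 * μHE[d] (simplex s) := by
  set V := volume (Metric.ball (0 : 𝔼 d) r) with hV
  have hVtop : V ≠ ⊤ := measure_ball_lt_top.ne
  set C : ℝ≥0∞ := (K : ℝ≥0∞) ^ d * ((K : ℝ≥0∞) ^ d *
    ((4 * ENNReal.ofReal (2 * r) ^ 2 * 2 ^ Module.finrank ℝ (𝔼 d) * V) *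
      ((K : ℝ≥0∞) ^ 2 * (K : ℝ≥0∞) ^ d))) with hC
  refine ⟨C.toNNReal, fun Γ π 𝒦 a ha h𝒦 f ℓ hfm hfc hlip => ?_⟩
  obtain ⟨θ, hθ⟩ := h𝒦.exists_chart a ha
  rw [ENNReal.coe_toNNReal (by finiteness)]
  set B := Metric.ball (0 : 𝔼 d) r with hB
  have hfin : μHE[d] (θ '' B) < ⊤ :=
    (hθ.measure_image_le subset_rfl).trans_lt (ENNReal.mul_lt_top (by finiteness)
      (lt_top_iff_ne_top.2 hVtop))
  have : IsFiniteMeasure ((μHE[d] : Measure (𝔼 k)).restrict (θ '' B)) :=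
    ⟨by rwa [Measure.restrict_apply_univ]⟩
  have h1 : pairEnergy ((μHE[d] : Measure (𝔼 k)).restrict 𝒦.carrier) f
      (π ⁻¹' Metric.ball a (r / K)) (π ⁻¹' Metric.ball a (r / K)) ≤
      pairEnergy μHE[d] f (θ '' B) (θ '' B) := by
    unfold pairEnergy
    rw [Measure.restrict_restrict' 𝒦.isCompact_carrier.measurableSet]
    exact pairEnergy_mono (inter_carrier_subset_image hθ) (inter_carrier_subset_image hθ)
  refine h1.trans ((hθ.pairEnergy_image_le hfm).trans ?_)
  have hθc : ContinuousOn θ B := hθ.lipschitzOnWith.continuousOn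
  have h2 := lintegral_lintegral_sq_sub_le (volume : Measure (𝔼 d)) (convex_ball 0 r)
    measurableSet_ball (R := 2 * r) (by positivity) (fun x hx y hy => by
      rw [mem_ball_zero_iff] at hx hy
      linarith [norm_sub_le y x]) (f := fun u => f (θ u)) (hfc.comp hθc hθ.mapsTo) 𝒦.cells
    (fun s => B ∩ θ ⁻¹' simplex s) (fun s _ => measurableSet_inter_preimage
        Metric.isOpen_ball hθc (isCompact_simplex s).isClosed) (fun u hu => by
      obtain ⟨s, hs, hus⟩ := mem_iUnion₂.1 (hθ.mapsTo u hu)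
      exact mem_iUnion₂.2 ⟨s, hs, hu, hus⟩) (fun s => ℓ s * K) (fun s hs =>
      (hlip s hs).comp (hθ.lipschitzOnWith.mono inter_subset_left) fun u hu => hu.2)
  have h3 : ∑ s ∈ 𝒦.cells, ((ℓ s * K : ℝ≥0) : ℝ≥0∞) ^ 2 * volume (B ∩ θ ⁻¹' simplex s) ≤
      ((K : ℝ≥0∞) ^ 2 * (K : ℝ≥0∞) ^ d) *
        ∑ s ∈ 𝒦.cells, (ℓ s : ℝ≥0∞) ^ 2 * μHE[d] (simplex s) := by
    rw [Finset.mul_sum]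
    refine Finset.sum_le_sum fun s _ => ?_
    have h4 : volume (B ∩ θ ⁻¹' simplex s) ≤ (K : ℝ≥0∞) ^ d * μHE[d] (simplex s) := by
      refine (hθ.le_measure_image inter_subset_left).trans ?_
      gcongr
      rintro _ ⟨u, hu, rfl⟩
      exact hu.2
    calc _ ≤ ((ℓ s * K : ℝ≥0) : ℝ≥0∞) ^ 2 * ((K : ℝ≥0∞) ^ d * μHE[d] (simplex s)) := by gcongr
      _ = _ := by push_cast; ring
  calc _ ≤ (K : ℝ≥0∞) ^ d * ((K : ℝ≥0∞) ^ d *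
        ((4 * ENNReal.ofReal (2 * r) ^ 2 * 2 ^ Module.finrank ℝ (𝔼 d) * V) *
          (((K : ℝ≥0∞) ^ 2 * (K : ℝ≥0∞) ^ d) *
            ∑ s ∈ 𝒦.cells, (ℓ s : ℝ≥0∞) ^ 2 * μHE[d] (simplex s)))) := by
        gcongr
        exact h2.trans (by gcongr)
    _ = _ := by rw [hC]; ring

/-- Global Poincaré inequality on discrete manifolds, in double integral form. -/
theorem exists_pairEnergy_carrier_le (hΓ : IsCompact Γ) (hΓc : IsPreconnected Γ) (hr : 0 < r)
    (hK : 0 < K) :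
    ∃ C : ℝ≥0, ∀ (𝒦 : Mesh d k) (v : (𝔼 k) → ℝ) (ℓ : Finset (𝔼 k) → ℝ≥0),
      HasLipCharts Γ π r K 𝒦 → ContinuousOn v 𝒦.carrier →
      (∀ s ∈ 𝒦.cells, LipschitzOnWith (ℓ s) v (simplex s)) →
      pairEnergy μHE[d] v 𝒦.carrier 𝒦.carrier ≤
        C * ∑ s ∈ 𝒦.cells, (ℓ s : ℝ≥0∞) ^ 2 * μHE[d] (simplex s) := by
  obtain ⟨M, hM⟩ := exists_surface_measure_le (d := d) (π := π) hΓ hr hK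
  obtain ⟨C, hC⟩ := exists_local_pairEnergy_le (k := k) (d := d) r hr K
  let κ := {i : Mesh d k × ((𝔼 k) → ℝ) × (Finset (𝔼 k) → ℝ≥0) //
    HasLipCharts Γ π r K i.1 ∧ Measurable i.2.1 ∧ ContinuousOn i.2.1 i.1.carrier ∧
      ∀ s ∈ i.1.cells, LipschitzOnWith (i.2.2 s) i.2.1 (simplex s)}
  have hfin : ∀ i : κ, IsFiniteMeasure ((μHE[d] : Measure (𝔼 k)).restrict i.1.1.carrier) :=
    fun i => ⟨by
      rw [Measure.restrict_apply_univ]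
      exact (hM _ i.2.1).trans_lt ENNReal.coe_lt_top⟩
  obtain ⟨C', hC'⟩ := exists_pairEnergy_le (κ := κ) hΓ hΓc
    (fun i => (μHE[d] : Measure (𝔼 k)).restrict i.1.1.carrier) (fun i => i.1.2.1)
    (fun i => i.2.2.1) (fun i => ∑ s ∈ i.1.1.cells, (i.1.2.2 s : ℝ≥0∞) ^ 2 * μHE[d] (simplex s))
    (fun _ => π) M (fun i => by
      rw [Measure.restrict_apply_univ]
      exact hM _ i.2.1)
    (fun a ha s hs => by
      obtain ⟨m, hm, h⟩ := exists_le_surface_measure (d := d) (π := π) hr hK ha hs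
      exact ⟨m, hm, fun i => h _ i.2.1⟩)
    (fun a ha => ⟨r / K, by positivity, C, fun i =>
      hC Γ π i.1.1 a ha i.2.1 _ _ i.2.2.1 i.2.2.2.1 i.2.2.2.2⟩)
  refine ⟨C', fun 𝒦 v ℓ h𝒦 hv hlip => ?_⟩
  have hmeas : MeasurableSet 𝒦.carrier := 𝒦.isCompact_carrier.measurableSet
  classical
  have hfm : Measurable (𝒦.carrier.piecewise v 0) :=
    hv.measurable_piecewise continuousOn_const hmeas
  have heq : EqOn (𝒦.carrier.piecewise v 0) v 𝒦.carrier := piecewise_eqOn _ _ _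
  have h1 := hC' ⟨(𝒦, 𝒦.carrier.piecewise v 0, ℓ), h𝒦, hfm, hv.congr heq, fun s hs x hx y hy => by
      simp only
      rw [heq (𝒦.simplex_subset_carrier hs hx), heq (𝒦.simplex_subset_carrier hs hy)]
      exact hlip s hs hx hy⟩
  refine le_trans ?_ h1
  refine le_trans ?_ (pairEnergy_mono (S₁ := 𝒦.carrier) (S₁' := 𝒦.carrier)
    (fun x hx => h𝒦.mapsTo hx) (fun x hx => h𝒦.mapsTo hx))
  unfold pairEnergy
  rw [Measure.restrict_restrict hmeas, inter_self]
  refine le_of_eq (setLIntegral_congr_fun hmeas fun x hx => ?_)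
  refine setLIntegral_congr_fun hmeas fun y hy => ?_
  simp only [heq hx, heq hy]

theorem ofReal_setIntegral_sq_sub_average_le {X : Type*} [TopologicalSpace X] [T2Space X]
    [MeasurableSpace X] [BorelSpace X] {μ : Measure X} {S : Set X} (hS : IsCompact S)
    (hμ : μ S ≠ ⊤) (hμ0 : μ S ≠ 0) {v : X → ℝ} (hv : ContinuousOn v S) :
    ENNReal.ofReal (∫ x in S, (v x - ⨍ y in S, v y ∂μ) ^ 2 ∂μ) * μ S ≤ pairEnergy μ v S S := by
  set a := ⨍ y in S, v y ∂μ with ha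
  have hint : ∀ g : X → ℝ, ContinuousOn g S → IntegrableOn g S μ := fun g hg => by
    obtain ⟨B, hB⟩ := hS.exists_bound_of_continuousOn hg
    exact IntegrableOn.of_bound (lt_top_iff_ne_top.2 hμ)
      (hg.aestronglyMeasurable_of_isCompact hS hS.measurableSet) B
      ((ae_restrict_iff' hS.measurableSet).2 (Filter.Eventually.of_forall hB))
  have hmean : ∫ y in S, v y ∂μ = μ.real S * a := by
    rw [ha, setAverage_eq, smul_eq_mul, mul_inv_cancel_left₀]
    exact (ENNReal.toReal_pos hμ0 hμ).ne'
  have hpt : ∀ x, (v x - a) ^ 2 * μ.real S ≤ ∫ y in S, (v x - v y) ^ 2 ∂μ := by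
    intro x
    have h1 : ∫ y in S, ((v x - a) ^ 2 + 2 * (v x - a) * (a - v y)) ∂μ =
        (v x - a) ^ 2 * μ.real S := by
      have hi := hint v hv
      rw [integral_add (hint _ continuousOn_const)
        (hint (fun y => 2 * (v x - a) * (a - v y)) (by fun_prop)), integral_const_mul,
        integral_sub (hint _ continuousOn_const) hi, hmean]
      simp only [integral_const, measureReal_restrict_apply_univ, smul_eq_mul]
      ring
    rw [← h1]
    refine integral_mono (hint _ (by fun_prop)) (hint _ (by fun_prop)) fun y => ?_
    simp only
    nlinarith [sq_nonneg (a - v y)]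
  rw [ofReal_integral_eq_lintegral_ofReal (hint _ (by fun_prop))
    (Filter.Eventually.of_forall fun x => sq_nonneg _), ← lintegral_mul_const' _ _ hμ]
  refine lintegral_mono fun x => ?_
  rw [← ofReal_integral_eq_lintegral_ofReal (hint _ (by fun_prop))
    (Filter.Eventually.of_forall fun x => sq_nonneg _)]
  refine le_trans (le_of_eq ?_) (ENNReal.ofReal_le_ofReal (hpt x))
  rw [ENNReal.ofReal_mul (sq_nonneg _), ofReal_measureReal hμ]

/-- The Poincaré inequality on discrete manifolds. -/
theorem exists_surface_poincare (hΓ : IsCompact Γ) (hΓc : IsConnected Γ) (hr : 0 < r)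
    (hK : 0 < K) :
    ∃ C > 0, ∀ (𝒦 : Mesh d k) (v : (𝔼 k) → ℝ) (ℓ : Finset (𝔼 k) → ℝ≥0),
      HasLipCharts Γ π r K 𝒦 → ContinuousOn v 𝒦.carrier →
      (∀ s ∈ 𝒦.cells, LipschitzOnWith (ℓ s) v (simplex s)) →
      ∫ x in 𝒦.carrier, (v x - surfaceMean 𝒦 v) ^ 2 ∂μHE[d] ≤
        C * ∑ s ∈ 𝒦.cells, (ℓ s : ℝ) ^ 2 * (μHE[d] : Measure (𝔼 k)).real (simplex s) := by
  obtain ⟨M, hM⟩ := exists_surface_measure_le (d := d) (π := π) hΓ hr hK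
  obtain ⟨C, hC⟩ := exists_pairEnergy_carrier_le (d := d) (π := π) hΓ hΓc.isPreconnected hr hK
  obtain ⟨a, ha⟩ := hΓc.nonempty
  obtain ⟨m, hm, hlow⟩ := exists_le_surface_measure (d := d) (π := π) hr hK ha one_pos
  refine ⟨(C + 1) / m, by positivity, fun 𝒦 v ℓ h𝒦 hv hlip => ?_⟩
  have hfin : ∀ s ∈ 𝒦.cells, μHE[d] (simplex s) ≠ ⊤ := fun s hs =>
    ((measure_mono (𝒦.simplex_subset_carrier hs)).trans_lt
      ((hM 𝒦 h𝒦).trans_lt ENNReal.coe_lt_top)).ne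
  have hm' : (m : ℝ≥0∞) ≤ μHE[d] 𝒦.carrier := (hlow 𝒦 h𝒦).trans (by
    rw [Measure.restrict_apply' 𝒦.isCompact_carrier.measurableSet]
    exact measure_mono inter_subset_right)
  have h1 := (ofReal_setIntegral_sq_sub_average_le 𝒦.isCompact_carrier
    ((hM 𝒦 h𝒦).trans_lt ENNReal.coe_lt_top).ne
    (lt_of_lt_of_le (by exact_mod_cast hm) hm').ne' hv).trans (hC 𝒦 v ℓ h𝒦 hv hlip)
  have h2 := (mul_le_mul_right hm' _).trans h1
  rw [← ENNReal.ofReal_coe_nnreal (p := m), ← ENNReal.ofReal_mul' m.coe_nonneg,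
    ENNReal.ofReal_le_iff_le_toReal (ENNReal.mul_ne_top ENNReal.coe_ne_top
      (ENNReal.sum_ne_top.2 fun s hs => ENNReal.mul_ne_top (by finiteness) (hfin s hs))),
    ENNReal.toReal_mul, ENNReal.toReal_sum fun s hs => ENNReal.mul_ne_top (by finiteness)
      (hfin s hs)] at h2
  simp only [ENNReal.toReal_mul, ENNReal.toReal_pow, ENNReal.coe_toReal] at h2
  rw [div_mul_eq_mul_div, le_div_iff₀ (by exact_mod_cast hm)]
  refine h2.trans ?_
  gcongr
  · linarith
  · rfl

end Surface

/-- The active cells contained in the ball of radius `ρ` about `x`. -/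
def nearCells (𝒯 : Mesh k k) (S : Set (𝔼 k)) (x : 𝔼 k) (ρ : ℝ) : Finset (Finset (𝔼 k)) :=
  open Classical in (activeCells 𝒯 S).filter fun t => simplex t ⊆ Metric.closedBall x ρ

theorem mem_nearCells {𝒯 : Mesh k k} {S : Set (𝔼 k)} {x : 𝔼 k} {ρ : ℝ} {t : Finset (𝔼 k)} :
    t ∈ nearCells 𝒯 S x ρ ↔ t ∈ activeCells 𝒯 S ∧ simplex t ⊆ Metric.closedBall x ρ := by
  classical
  simp [nearCells]

theorem Mesh.QuasiUniform.subset_closedBall {M : Mesh k k} {h σ : ℝ} (hM : M.QuasiUniform h σ)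
    {t : Finset (𝔼 k)} (ht : t ∈ M.cells) {x z : 𝔼 k} (hz : z ∈ simplex t) {ρ : ℝ}
    (hρ : dist z x + σ * h ≤ ρ) : simplex t ⊆ Metric.closedBall x ρ := fun y hy => by
  have h1 := hM.dist_le ht hy hz
  have h2 := dist_triangle y z x
  rw [Metric.mem_closedBall]
  linarith

/-- Bounded overlap for integrals of nonnegative functions. -/
theorem sum_setIntegral_le_of_overlap {ι X : Type*} [MeasurableSpace X] {μ : Measure X} {S : Set X}
    (hSm : MeasurableSet S) (I : Finset ι) (W : ι → Set X) (hWm : ∀ i ∈ I, MeasurableSet (W i))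
    (hWS : ∀ i ∈ I, W i ⊆ S) {g : X → ℝ} (hg0 : ∀ x, 0 ≤ g x) (hg : IntegrableOn g S μ) {N : ℝ}
    (hN : ∀ x ∈ S, ∀ J ⊆ I, (∀ i ∈ J, x ∈ W i) → (J.card : ℝ) ≤ N) :
    ∑ i ∈ I, ∫ x in W i, g x ∂μ ≤ N * ∫ x in S, g x ∂μ := by
  classical
  have h1 : ∀ i ∈ I, ∫ x in W i, g x ∂μ = ∫ x in S, (W i).indicator g x ∂μ := fun i hi => by
    rw [setIntegral_indicator (hWm i hi), inter_eq_self_of_subset_right (hWS i hi)]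
  rw [Finset.sum_congr rfl h1, ← integral_finsetSum _ fun i hi => hg.indicator (hWm i hi),
    ← integral_const_mul]
  refine setIntegral_mono_on (integrable_finsetSum _ fun i hi => hg.indicator (hWm i hi))
    (hg.const_mul N) hSm fun x hx => ?_
  have h2 : ∑ i ∈ I, (W i).indicator g x = ((I.filter fun i => x ∈ W i).card : ℝ) * g x := by
    simp only [indicator_apply]
    rw [← Finset.sum_filter, Finset.sum_const, nsmul_eq_mul]
  rw [h2]
  gcongr
  · exact hg0 x
  · exact hN x hx _ (Finset.filter_subset _ _) fun i hi => (Finset.mem_filter.1 hi).2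

/-- Bounded overlap for sums of nonnegative numbers. -/
theorem sum_sum_le_of_overlap {ι : Type*} (I : Finset ι) (n : ι → Finset ι) (hn : ∀ i ∈ I, n i ⊆ I)
    (a : ι → ℝ) (ha : ∀ i ∈ I, 0 ≤ a i) {N : ℝ}
    (hN : ∀ j ∈ I, ∀ J ⊆ I, (∀ i ∈ J, j ∈ n i) → (J.card : ℝ) ≤ N) :
    ∑ i ∈ I, ∑ j ∈ n i, a j ≤ N * ∑ j ∈ I, a j := by
  classical
  have h1 : ∑ i ∈ I, ∑ j ∈ n i, a j = ∑ j ∈ I, ∑ i ∈ I.filter (fun i => j ∈ n i), a j := by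
    refine Finset.sum_comm' fun i j => ?_
    simp only [Finset.mem_filter]
    exact ⟨fun h => ⟨h, hn i h.1 h.2⟩, fun h => h.1⟩
  rw [h1, Finset.mul_sum]
  refine Finset.sum_le_sum fun j hj => ?_
  rw [Finset.sum_const, nsmul_eq_mul]
  gcongr
  · exact ha j hj
  · exact hN j hj _ (Finset.filter_subset _ _) fun i hi => (Finset.mem_filter.1 hi).2

section Local

variable {Γ : Set (𝔼 k)} {π : (𝔼 k) → 𝔼 k} {r h σ : ℝ} {K : ℝ≥0} {𝒯 : Mesh k k} {𝒦 : Mesh d k}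
  {v : (𝔼 k) → ℝ} {ℓ : Finset (𝔼 k) → ℝ≥0}

/-- Along the discrete manifold, at the scale of the mesh, increments of a discrete function are
bounded by its gradients on the nearby active cells. -/
theorem abs_sub_le_sum_nearCells (hM : 𝒯.QuasiUniform h σ) (hh : 0 < h) (hσ : 0 < σ) (hhr : h < r)
    (hsub : 𝒦.carrier ⊆ 𝒯.carrier) (hv : ContinuousOn v 𝒦.carrier)
    (hlip : ∀ t ∈ activeCells 𝒯 𝒦.carrier, LipschitzOnWith (ℓ t) v (simplex t))
    {a : 𝔼 k} {θ : (𝔼 d) → 𝔼 k} (hθ : IsLipChart 𝒦.carrier π r K a θ) {u : 𝔼 d} (hu : ‖u‖ ≤ h) :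
    |v (θ u) - v (θ 0)| ≤
      σ * h * ∑ t ∈ nearCells 𝒯 𝒦.carrier (θ 0) ((K + σ) * h), (ℓ t : ℝ) := by
  have hsu : ∀ s ∈ Icc (0 : ℝ) 1, s • u ∈ Metric.ball (0 : 𝔼 d) r ∧ ‖s • u‖ ≤ h := by
    intro s hs
    have h1 : ‖s • u‖ ≤ h := by
      rw [norm_smul, Real.norm_eq_abs, abs_of_nonneg hs.1]
      nlinarith [hs.2, norm_nonneg u]
    exact ⟨mem_ball_zero_iff.2 (h1.trans_lt hhr), h1⟩
  have hcont : ContinuousOn (fun s : ℝ => v (θ (s • u))) (Icc 0 1) := by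
    refine hv.comp (hθ.lipschitzOnWith.continuousOn.comp (by fun_prop) fun s hs => (hsu s hs).1) ?_
    exact fun s hs => hθ.mapsTo _ (hsu s hs).1
  have h1 := ofReal_abs_sub_le_sum_volume_image hcont
    (nearCells 𝒯 𝒦.carrier (θ 0) ((K + σ) * h)) (fun t => {s | θ (s • u) ∈ simplex t}) (by
      intro s hs
      obtain ⟨t, ht, hst⟩ := exists_activeCell hsub (hθ.mapsTo _ (hsu s hs).1)
      refine mem_iUnion₂.2 ⟨t, mem_nearCells.2 ⟨ht, ?_⟩, hst⟩
      refine hM.subset_closedBall (mem_activeCells.1 ht).1 hst ?_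
      have h2 := hθ.norm_sub_le _ (hsu s hs).1 0 (Metric.mem_ball_self (hh.trans hhr))
      rw [sub_zero, ← dist_eq_norm] at h2
      have h3 : (K : ℝ) * ‖s • u‖ ≤ K * h := by gcongr; exact (hsu s hs).2
      linarith)
  simp only [one_smul, zero_smul] at h1
  have h2 : ∀ t ∈ nearCells 𝒯 𝒦.carrier (θ 0) ((K + σ) * h),
      volume ((fun s : ℝ => v (θ (s • u))) '' ({s | θ (s • u) ∈ simplex t} ∩ Icc 0 1)) ≤
        ENNReal.ofReal (σ * h * ℓ t) := by
    intro t ht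
    have ht' := (mem_nearCells.1 ht).1
    refine (Real.volume_le_diam _).trans (Metric.ediam_le ?_)
    rintro _ ⟨s, hs, rfl⟩ _ ⟨s', hs', rfl⟩
    rw [edist_dist]
    refine ENNReal.ofReal_le_ofReal ?_
    refine ((hlip t ht').dist_le_mul _ hs.1 _ hs'.1).trans ?_
    have := hM.dist_le (mem_activeCells.1 ht').1 hs.1 hs'.1
    rw [mul_comm (σ * h)]
    gcongr
  have h3 := h1.trans (Finset.sum_le_sum h2)
  rw [← ENNReal.ofReal_sum_of_nonneg fun t _ => by positivity, ← Finset.mul_sum] at h3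
  exact (ENNReal.ofReal_le_ofReal_iff (mul_nonneg (by positivity)
    (Finset.sum_nonneg fun t _ => (ℓ t).coe_nonneg))).1 h3

/-- The local estimate on one active cell. -/
theorem setIntegral_sq_sub_le (hk : k = d + c) (hM : 𝒯.QuasiUniform h σ) (hh : 0 < h) (hσ : 0 < σ)
    (hhr : h < r) (hK : 0 < K) (hsub : 𝒦.carrier ⊆ 𝒯.carrier) (hv : ContinuousOn v 𝒦.carrier)
    (hfin : μHE[d] 𝒦.carrier ≠ ⊤)
    (hlip : ∀ t ∈ activeCells 𝒯 𝒦.carrier, LipschitzOnWith (ℓ t) v (simplex t))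
    {a : 𝔼 k} {θ : (𝔼 d) → 𝔼 k} (hθ : IsLipChart 𝒦.carrier π r K a θ) {T : Finset (𝔼 k)}
    (hT : T ∈ activeCells 𝒯 𝒦.carrier) (hθT : θ 0 ∈ simplex T) (b : ℝ) :
    ∫ x in simplex T, (v x - b) ^ 2 ≤
      (2 * σ ^ k * volume.real (Metric.ball (0 : 𝔼 k) 1) * K ^ d /
        volume.real (Metric.ball (0 : 𝔼 d) 1)) * h ^ c *
          ∫ y in θ '' Metric.closedBall 0 h, (v y - b) ^ 2 ∂μHE[d] +
      (8 * σ ^ 2 * σ ^ (2 * k) * ((K + σ) * σ) ^ k) * h ^ 2 *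
        ∑ t ∈ nearCells 𝒯 𝒦.carrier (θ 0) ((K + σ) * h),
          (ℓ t : ℝ) ^ 2 * volume.real (simplex t) := by
  set near := nearCells 𝒯 𝒦.carrier (θ 0) ((K + σ) * h) with hnear
  set βk := volume.real (Metric.ball (0 : 𝔼 k) 1) with hβk
  set βd := volume.real (Metric.ball (0 : 𝔼 d) 1) with hβd
  have hβk0 : 0 < βk := ENNReal.toReal_pos (Metric.measure_ball_pos volume _ one_pos).ne'
    measure_ball_lt_top.ne
  have hβd0 : 0 < βd := ENNReal.toReal_pos (Metric.measure_ball_pos volume _ one_pos).ne'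
    measure_ball_lt_top.ne
  have hK0 : (0 : ℝ) < K := by exact_mod_cast hK
  set W := θ '' Metric.closedBall 0 h with hW
  have hballsub : Metric.closedBall (0 : 𝔼 d) h ⊆ Metric.ball 0 r :=
    Metric.closedBall_subset_ball hhr
  have hWc : IsCompact W := (isCompact_closedBall _ _).image_of_continuousOn
    (hθ.lipschitzOnWith.continuousOn.mono hballsub)
  have hWS : W ⊆ 𝒦.carrier := by
    rintro _ ⟨u, hu, rfl⟩
    exact hθ.mapsTo u (hballsub hu)
  have hWfin : μHE[d] W ≠ ⊤ := ((measure_mono hWS).trans_lt (lt_top_iff_ne_top.2 hfin)).ne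
  set N : ℝ := ((K + σ) * σ) ^ k with hN
  set Q := ∑ t ∈ near, (ℓ t : ℝ) ^ 2 with hQ
  have hQ0 : 0 ≤ Q := Finset.sum_nonneg fun t _ => sq_nonneg _
  have hcard : (near.card : ℝ) ≤ N := hM.card_le hh hσ (by positivity) (θ 0) near
    (fun t ht => (mem_activeCells.1 (mem_nearCells.1 ht).1).1) fun t ht => (mem_nearCells.1 ht).2
  have hTcell := (mem_activeCells.1 hT).1
  have hTnear : T ∈ near := mem_nearCells.2 ⟨hT, hM.subset_closedBall hTcell hθT (by
    rw [dist_self]; nlinarith [mul_pos hK0 hh])⟩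
  -- pointwise comparison
  have hpt : ∀ x ∈ simplex T, ∀ y ∈ W,
      (v x - b) ^ 2 ≤ 2 * (v y - b) ^ 2 + 8 * σ ^ 2 * h ^ 2 * N * Q := by
    rintro x hx _ ⟨u, hu, rfl⟩
    have h1 := abs_sub_le_sum_nearCells hM hh hσ hhr hsub hv hlip hθ (mem_closedBall_zero_iff.1 hu)
    have h2 : |v x - v (θ 0)| ≤ σ * h * ∑ t ∈ near, (ℓ t : ℝ) := by
      have h3 := (hlip T hT).dist_le_mul _ hx _ hθT
      have h4 := hM.dist_le hTcell hx hθT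
      rw [Real.dist_eq] at h3
      calc |v x - v (θ 0)| ≤ ℓ T * (σ * h) := h3.trans (by gcongr)
        _ = σ * h * ℓ T := by ring
        _ ≤ _ := by
          gcongr
          exact Finset.single_le_sum (f := fun t => (ℓ t : ℝ)) (fun t _ => (ℓ t).coe_nonneg) hTnear
    have h3 : |v x - v (θ u)| ≤ 2 * (σ * h) * ∑ t ∈ near, (ℓ t : ℝ) := by
      have := abs_sub_le (v x) (v (θ 0)) (v (θ u))
      rw [abs_sub_comm (v (θ 0))] at this
      linarith
    have h4 : (∑ t ∈ near, (ℓ t : ℝ)) ^ 2 ≤ N * Q :=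
      sq_sum_le_card_mul_sum_sq.trans (by gcongr)
    have h5 : (v x - v (θ u)) ^ 2 ≤ 4 * σ ^ 2 * h ^ 2 * (N * Q) := by
      rw [← sq_abs]
      calc |v x - v (θ u)| ^ 2 ≤ (2 * (σ * h) * ∑ t ∈ near, (ℓ t : ℝ)) ^ 2 := by gcongr
        _ = 4 * σ ^ 2 * h ^ 2 * (∑ t ∈ near, (ℓ t : ℝ)) ^ 2 := by ring
        _ ≤ _ := by gcongr
    nlinarith [sq_nonneg ((v x - v (θ u)) - (v (θ u) - b))]
  set X := ∫ x in simplex T, (v x - b) ^ 2 with hX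
  set Y := ∫ y in W, (v y - b) ^ 2 ∂μHE[d] with hY
  have hY0 : 0 ≤ Y := integral_nonneg fun y => sq_nonneg _
  set VT := volume.real (simplex T) with hVT
  set w := (μHE[d] : Measure (𝔼 k)).real W with hw
  -- integrate over the cell
  have hXle : ∀ y ∈ W, X ≤ VT * (2 * (v y - b) ^ 2 + 8 * σ ^ 2 * h ^ 2 * N * Q) := by
    intro y hy
    have hvc : ContinuousOn v (simplex T) := (hlip T hT).continuousOn
    have h1 : IntegrableOn (fun x => (v x - b) ^ 2) (simplex T) volume :=
      ContinuousOn.integrableOn_compact (isCompact_simplex T) (by fun_prop)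
    have h2 := setIntegral_mono_on h1 (integrableOn_const (isCompact_simplex T).measure_lt_top.ne)
      (isCompact_simplex T).measurableSet (fun x hx => hpt x hx y hy)
    rwa [setIntegral_const, smul_eq_mul] at h2
  -- integrate over the surface patch
  have hXw : w * X ≤ VT * (2 * Y + 8 * σ ^ 2 * h ^ 2 * N * Q * w) := by
    have hvW : ContinuousOn v W := hv.mono hWS
    have hint : IntegrableOn (fun y => (v y - b) ^ 2) W μHE[d] := by
      have hg : ContinuousOn (fun y => (v y - b) ^ 2) W := by fun_prop
      obtain ⟨B, hB⟩ := hWc.exists_bound_of_continuousOn hg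
      exact IntegrableOn.of_bound (lt_top_iff_ne_top.2 hWfin)
        (hg.aestronglyMeasurable_of_isCompact hWc hWc.measurableSet) B
        ((ae_restrict_iff' hWc.measurableSet).2 (Filter.Eventually.of_forall hB))
    have h2 := setIntegral_mono_on (μ := μHE[d]) (integrableOn_const hWfin)
      (((hint.const_mul 2).add (integrableOn_const (C := 8 * σ ^ 2 * h ^ 2 * N * Q)
        hWfin)).const_mul VT) hWc.measurableSet hXle
    rw [setIntegral_const, smul_eq_mul, integral_const_mul,
      integral_add' (hint.const_mul 2) (integrableOn_const hWfin), integral_const_mul,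
      setIntegral_const, smul_eq_mul] at h2
    refine h2.trans (le_of_eq ?_)
    rw [mul_comm w]
  -- sizes
  have hVTle : VT ≤ (σ * h) ^ k * βk := by
    have h1 := Measure.addHaar_real_closedBall (volume : Measure (𝔼 k)) (θ 0)
      (r := σ * h) (by positivity)
    rw [finrank_euclideanSpace_fin] at h1
    rw [← h1]
    exact measureReal_mono (hM.subset_closedBall hTcell hθT (by rw [dist_self, zero_add]))
      measure_closedBall_lt_top.ne
  have hwge : h ^ d * βd ≤ K ^ d * w := by
    have h1 := Measure.addHaar_real_closedBall (volume : Measure (𝔼 d)) 0 hh.le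
    rw [finrank_euclideanSpace_fin] at h1
    rw [← h1]
    have h2 := ENNReal.toReal_mono (ENNReal.mul_ne_top (by finiteness) hWfin)
      (hθ.le_measure_image hballsub)
    rwa [ENNReal.toReal_mul, ENNReal.toReal_pow, ENNReal.coe_toReal] at h2
  have hw0 : 0 < w := by
    have : 0 < (K : ℝ) ^ d * w := lt_of_lt_of_le (by positivity) hwge
    exact pos_of_mul_pos_right this (by positivity)
  have hQle : (σ * h) ^ k * βk * Q ≤
      σ ^ (2 * k) * ∑ t ∈ near, (ℓ t : ℝ) ^ 2 * volume.real (simplex t) := by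
    rw [hQ, Finset.mul_sum, Finset.mul_sum]
    refine Finset.sum_le_sum fun t ht => ?_
    have h1 := hM.le_volume_real hh hσ (mem_activeCells.1 (mem_nearCells.1 ht).1).1
    calc (σ * h) ^ k * βk * (ℓ t : ℝ) ^ 2
        = σ ^ (2 * k) * ((ℓ t : ℝ) ^ 2 * ((h / σ) ^ k * βk)) := by
          rw [div_pow, mul_pow, two_mul, pow_add]
          field_simp
      _ ≤ _ := by gcongr
  have hXfin : X ≤ VT * 2 * Y / w + VT * (8 * σ ^ 2 * h ^ 2 * N * Q) := by
    have h1 : X ≤ VT * (2 * Y + 8 * σ ^ 2 * h ^ 2 * N * Q * w) / w := by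
      rw [le_div_iff₀ hw0]
      linarith
    refine h1.trans (le_of_eq ?_)
    field_simp
  refine hXfin.trans (add_le_add ?_ ?_)
  · rw [div_le_iff₀ hw0]
    have h1 : VT ≤ σ ^ k * βk * h ^ c * (K ^ d * w / βd) := by
      have h2 : h ^ d ≤ K ^ d * w / βd := by rwa [le_div_iff₀ hβd0]
      calc VT ≤ σ ^ k * βk * h ^ c * h ^ d := by
            refine hVTle.trans (le_of_eq ?_)
            rw [hk, mul_pow, pow_add h]
            ring
        _ ≤ _ := by gcongr
    calc VT * 2 * Y ≤ (σ ^ k * βk * h ^ c * (K ^ d * w / βd)) * 2 * Y := by gcongr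
      _ = _ := by ring
  · calc VT * (8 * σ ^ 2 * h ^ 2 * N * Q) ≤ ((σ * h) ^ k * βk) * (8 * σ ^ 2 * h ^ 2 * N * Q) := by
          have : 0 ≤ N := by positivity
          gcongr
      _ = 8 * σ ^ 2 * h ^ 2 * N * ((σ * h) ^ k * βk * Q) := by ring
      _ ≤ 8 * σ ^ 2 * h ^ 2 * N * (σ ^ (2 * k) *
          ∑ t ∈ near, (ℓ t : ℝ) ^ 2 * volume.real (simplex t)) := by
          have : 0 ≤ N := by positivity
          gcongr
      _ = _ := by ring

end Local

theorem activeGradNormSq_eq {𝒯 : Mesh k k} {S : Set (𝔼 k)} {v : (𝔼 k) → ℝ}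
    {ℓ : Finset (𝔼 k) → ℝ≥0} (hℓ : ∀ t ∈ activeCells 𝒯 S, ∀ x ∈ simplex t,
      ‖gradientWithin v (simplex t) x‖ = ℓ t) :
    activeGradNormSq 𝒯 S v = ∑ t ∈ activeCells 𝒯 S, (ℓ t : ℝ) ^ 2 * volume.real (simplex t) := by
  refine Finset.sum_congr rfl fun t ht => ?_
  rw [setIntegral_congr_fun (g := fun _ => (ℓ t : ℝ) ^ 2) (isCompact_simplex t).measurableSet
    fun x hx => by simp only [hℓ t ht x hx], setIntegral_const, smul_eq_mul, mul_comm]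

theorem surfaceGradNormSq_eq {𝒦 : Mesh d k} {v : (𝔼 k) → ℝ}
    {ℓ : Finset (𝔼 k) → ℝ≥0} (hℓ : ∀ s ∈ 𝒦.cells, ∀ x ∈ simplex s,
      ‖tangentialGradient v (simplex s) x‖ = ℓ s) :
    surfaceGradNormSq 𝒦 v =
      ∑ s ∈ 𝒦.cells, (ℓ s : ℝ) ^ 2 * (μHE[d] : Measure (𝔼 k)).real (simplex s) := by
  refine Finset.sum_congr rfl fun s hs => ?_
  rw [setIntegral_congr_fun (g := fun _ => (ℓ s : ℝ) ^ 2) (isCompact_simplex s).measurableSet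
    fun x hx => by simp only [hℓ s hs x hx], setIntegral_const, smul_eq_mul, mul_comm]

/-- The `L²` norm on the active mesh is controlled by the one on the discrete manifold and the
gradient. -/
theorem exists_activeNormSq_le (hk : k = d + c) {r σ : ℝ} {K : ℝ≥0} (hσ : 0 < σ)
    (hK : 0 < K) :
    ∃ C > 0, ∀ (Γ : Set (𝔼 k)) (π : (𝔼 k) → 𝔼 k) (h : ℝ) (𝒯 : Mesh k k) (𝒦 : Mesh d k)
      (v : (𝔼 k) → ℝ) (ℓ : Finset (𝔼 k) → ℝ≥0) (b : ℝ), 0 < h → h < r → HasLipCharts Γ π r K 𝒦 →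
      InjOn π 𝒦.carrier → 𝒯.QuasiUniform h σ → 𝒦.carrier ⊆ 𝒯.carrier → μHE[d] 𝒦.carrier ≠ ⊤ →
      ContinuousOn v 𝒦.carrier →
      (∀ t ∈ activeCells 𝒯 𝒦.carrier, LipschitzOnWith (ℓ t) v (simplex t)) →
      activeNormSq 𝒯 𝒦.carrier (fun x => v x - b) ≤
        C * (h ^ c * ∫ y in 𝒦.carrier, (v y - b) ^ 2 ∂μHE[d] +
          h ^ 2 * ∑ t ∈ activeCells 𝒯 𝒦.carrier, (ℓ t : ℝ) ^ 2 * volume.real (simplex t)) := by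
  have hβk0 : 0 < volume.real (Metric.ball (0 : 𝔼 k) 1) :=
    ENNReal.toReal_pos (Metric.measure_ball_pos volume _ one_pos).ne' measure_ball_lt_top.ne
  have hβd0 : 0 < volume.real (Metric.ball (0 : 𝔼 d) 1) :=
    ENNReal.toReal_pos (Metric.measure_ball_pos volume _ one_pos).ne' measure_ball_lt_top.ne
  have hK0 : (0 : ℝ) < K := by exact_mod_cast hK
  set A : ℝ := 2 * σ ^ k * volume.real (Metric.ball (0 : 𝔼 k) 1) * K ^ d /
        volume.real (Metric.ball (0 : 𝔼 d) 1) with hA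
  set B : ℝ := 8 * σ ^ 2 * σ ^ (2 * k) * ((K + σ) * σ) ^ k with hB
  have hA0 : 0 < A := by positivity
  have hB0 : 0 < B := by positivity
  set N : ℝ := ((K + 2 * σ) * σ) ^ k with hN
  have hN0 : 0 < N := by positivity
  refine ⟨(A + B) * N, by positivity, ?_⟩
  intro Γ π h 𝒯 𝒦 v ℓ b hh hhr h𝒦 hinj hM hsub hfin hv hlip
  have hchart : ∀ T, ∃ (θ : (𝔼 d) → 𝔼 k) (a : 𝔼 k), T ∈ activeCells 𝒯 𝒦.carrier →
      IsLipChart 𝒦.carrier π r K a θ ∧ θ 0 ∈ simplex T := by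
    intro T
    by_cases hT : T ∈ activeCells 𝒯 𝒦.carrier
    · obtain ⟨x, hxT, hx⟩ := (mem_activeCells.1 hT).2
      obtain ⟨θ, hθ⟩ := h𝒦.exists_chart (π x) (h𝒦.mapsTo hx)
      have hr : 0 < r := hh.trans hhr
      have h0 : θ 0 = x := hinj (hθ.mapsTo 0 (Metric.mem_ball_self hr)) hx (hθ.center hr)
      exact ⟨θ, π x, fun _ => ⟨hθ, h0 ▸ hxT⟩⟩
    · exact ⟨fun _ => 0, 0, fun h => absurd h hT⟩
  choose θ a hθ using hchart
  have hballsub : Metric.closedBall (0 : 𝔼 d) h ⊆ Metric.ball 0 r :=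
    Metric.closedBall_subset_ball hhr
  set I := activeCells 𝒯 𝒦.carrier with hI
  have hcell : ∀ T ∈ I, T ∈ 𝒯.cells := fun T hT => (mem_activeCells.1 hT).1
  have hS : ∑ T ∈ I, ∫ y in θ T '' Metric.closedBall 0 h, (v y - b) ^ 2 ∂μHE[d] ≤
      N * ∫ y in 𝒦.carrier, (v y - b) ^ 2 ∂μHE[d] := by
    refine sum_setIntegral_le_of_overlap 𝒦.isCompact_carrier.measurableSet I _ (fun T hT => ?_)
      (fun T hT => ?_) (fun y => sq_nonneg _) ?_ ?_
    · exact ((isCompact_closedBall _ _).image_of_continuousOn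
        ((hθ T hT).1.lipschitzOnWith.continuousOn.mono hballsub)).measurableSet
    · rintro _ ⟨u, hu, rfl⟩
      exact (hθ T hT).1.mapsTo u (hballsub hu)
    · have hg : ContinuousOn (fun y => (v y - b) ^ 2) 𝒦.carrier := by fun_prop
      obtain ⟨D, hD⟩ := 𝒦.isCompact_carrier.exists_bound_of_continuousOn hg
      exact IntegrableOn.of_bound (lt_top_iff_ne_top.2 hfin)
        (hg.aestronglyMeasurable_of_isCompact 𝒦.isCompact_carrier
          𝒦.isCompact_carrier.measurableSet) D
        ((ae_restrict_iff' 𝒦.isCompact_carrier.measurableSet).2 (Filter.Eventually.of_forall hD))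
    · intro y hy J hJ hyJ
      refine hM.card_le hh hσ (by positivity) y J (fun T hT => hcell T (hJ hT)) fun T hT => ?_
      obtain ⟨u, hu, huy⟩ := hyJ T hT
      refine hM.subset_closedBall (hcell T (hJ hT)) (hθ T (hJ hT)).2 ?_
      have h1 := (hθ T (hJ hT)).1.norm_sub_le 0 (Metric.mem_ball_self (hh.trans hhr)) u
        (hballsub hu)
      rw [huy, ← dist_eq_norm, zero_sub, norm_neg] at h1
      have h2 : (K : ℝ) * ‖u‖ ≤ K * h := by gcongr; exact mem_closedBall_zero_iff.1 hu
      nlinarith [mul_pos hσ hh]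
  have hG : ∑ T ∈ I, ∑ t ∈ nearCells 𝒯 𝒦.carrier (θ T 0) ((K + σ) * h),
      (ℓ t : ℝ) ^ 2 * volume.real (simplex t) ≤
      N * ∑ t ∈ I, (ℓ t : ℝ) ^ 2 * volume.real (simplex t) := by
    refine sum_sum_le_of_overlap I _ (fun T _ t ht => (mem_nearCells.1 ht).1) _
      (fun t _ => by positivity) ?_
    intro j hj J hJ hjJ
    obtain ⟨z, hz⟩ := 𝒯.simplex_nonempty (hcell j hj)
    refine hM.card_le hh hσ (by positivity) z J (fun T hT => hcell T (hJ hT)) fun T hT => ?_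
    refine hM.subset_closedBall (hcell T (hJ hT)) (hθ T (hJ hT)).2 ?_
    have h1 := Metric.mem_closedBall.1 ((mem_nearCells.1 (hjJ T hT)).2 hz)
    rw [dist_comm] at h1
    linarith
  have hY0 : 0 ≤ ∫ y in 𝒦.carrier, (v y - b) ^ 2 ∂μHE[d] := integral_nonneg fun y => sq_nonneg _
  have hG0 : 0 ≤ ∑ t ∈ I, (ℓ t : ℝ) ^ 2 * volume.real (simplex t) :=
    Finset.sum_nonneg fun t _ => by positivity
  calc activeNormSq 𝒯 𝒦.carrier (fun x => v x - b)
      ≤ ∑ T ∈ I, (A * h ^ c * ∫ y in θ T '' Metric.closedBall 0 h, (v y - b) ^ 2 ∂μHE[d] +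
          B * h ^ 2 * ∑ t ∈ nearCells 𝒯 𝒦.carrier (θ T 0) ((K + σ) * h),
            (ℓ t : ℝ) ^ 2 * volume.real (simplex t)) :=
        Finset.sum_le_sum fun T hT => setIntegral_sq_sub_le hk hM hh hσ hhr hK hsub hv hfin hlip
          (hθ T hT).1 hT (hθ T hT).2 b
    _ = A * h ^ c * (∑ T ∈ I, ∫ y in θ T '' Metric.closedBall 0 h, (v y - b) ^ 2 ∂μHE[d]) +
          B * h ^ 2 * ∑ T ∈ I, ∑ t ∈ nearCells 𝒯 𝒦.carrier (θ T 0) ((K + σ) * h),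
            (ℓ t : ℝ) ^ 2 * volume.real (simplex t) := by
        rw [Finset.sum_add_distrib, Finset.mul_sum, Finset.mul_sum]
    _ ≤ A * h ^ c * (N * ∫ y in 𝒦.carrier, (v y - b) ^ 2 ∂μHE[d]) +
          B * h ^ 2 * (N * ∑ t ∈ I, (ℓ t : ℝ) ^ 2 * volume.real (simplex t)) := by gcongr
    _ ≤ (A + B) * h ^ c * (N * ∫ y in 𝒦.carrier, (v y - b) ^ 2 ∂μHE[d]) +
          (A + B) * h ^ 2 * (N * ∑ t ∈ I, (ℓ t : ℝ) ^ 2 * volume.real (simplex t)) := by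
        gcongr <;> linarith
    _ = _ := by ring

end CutFEM

end

end

theorem mainTheorem5 {k d c : ℕ} (hd : 1 ≤ d) (hc : 1 ≤ c) (hk : k = d + c)
    (Γ : Set (EuclideanSpace ℝ (Fin k)))
    (hΓ : CutFEM.IsSmoothSubmanifold d c Γ) (hΓ_compact : IsCompact Γ)
    (hΓ_conn : IsConnected Γ)
    (δ₀ : ℝ) (hδ₀ : 0 < δ₀) (hΓ_tube : CutFEM.HasUniqueClosestPoints Γ δ₀)
    (σ Cρ CP : ℝ) (hσ : 0 < σ) (hCρ : 0 < Cρ) (hCP : 0 < CP) :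
    ∃ h₀ > 0, ∃ C > 0, ∀ h : ℝ, 0 < h → h ≤ h₀ →
      ∀ (Ω : Set (EuclideanSpace ℝ (Fin k))) (𝒯 : CutFEM.Mesh k k) (𝒦 : CutFEM.Mesh d k),
        CutFEM.IsBackgroundMesh Γ δ₀ σ h Ω 𝒯 →
        CutFEM.IsDiscreteManifold Γ δ₀ Cρ CP h 𝒦 →
        CutFEM.Compatible 𝒯 𝒦 →
        ∀ v : EuclideanSpace ℝ (Fin k) → ℝ, CutFEM.IsDiscreteFunction 𝒯 𝒦.carrier v →
          h ^ (-(c : ℤ)) *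
              CutFEM.activeNormSq 𝒯 𝒦.carrier (fun x => v x - CutFEM.surfaceMean 𝒦 v) ≤
            C * (CutFEM.surfaceGradNormSq 𝒦 v +
              h ^ (2 - (c : ℤ)) * CutFEM.activeGradNormSq 𝒯 𝒦.carrier v) := by
  obtain ⟨r, hr, L, hL, h₁, hh₁, hcharts⟩ := CutFEM.exists_isLipChart_discrete (δ := δ₀) hΓ
    hΓ_compact hΓ_conn.nonempty hCρ hCP
  lift L to NNReal using by linarith
  have hL0 : 0 < L := lt_of_lt_of_le one_pos (by exact_mod_cast hL)
  obtain ⟨M, hM⟩ := CutFEM.exists_surface_measure_le (d := d) (π := CutFEM.closestPoint Γ)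
    hΓ_compact hr hL0
  obtain ⟨C₁, hC₁, hpoin⟩ := CutFEM.exists_surface_poincare (d := d)
    (π := CutFEM.closestPoint Γ) hΓ_compact hΓ_conn hr hL0
  obtain ⟨C₂, hC₂, hact⟩ := CutFEM.exists_activeNormSq_le (r := r) hk hσ hL0
  refine ⟨min h₁ (r / 2), lt_min hh₁ (half_pos hr), C₂ * (C₁ + 1), by positivity, ?_⟩
  intro h hh hh₀ Ω 𝒯 𝒦 h𝒯 h𝒦 hcomp v hv
  have hch : CutFEM.HasLipCharts Γ (CutFEM.closestPoint Γ) r L 𝒦 :=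
    ⟨h𝒦.bijOn.mapsTo, hcharts h hh (hh₀.trans (min_le_left _ _)) 𝒦 h𝒦⟩
  have hhr : h < r := lt_of_le_of_lt (hh₀.trans (min_le_right _ _)) (half_lt_self hr)
  have hsub := h𝒯.carrier_subset h𝒦
  have hvc : ContinuousOn v 𝒦.carrier := hv.1.mono fun x hx => by
    obtain ⟨t, ht, hxt⟩ := CutFEM.exists_activeCell hsub hx
    exact Set.mem_iUnion₂.2 ⟨t, ht, hxt⟩
  obtain ⟨ℓ, hℓ⟩ := CutFEM.exists_cellGradient h𝒯.quasiUniform hh hσ hv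
  obtain ⟨ℓ', hℓ'⟩ := CutFEM.exists_cellTangentialGradient hcomp hsub hv
  have h1 := hpoin 𝒦 v ℓ' hch hvc fun s hs => (hℓ' s hs).2
  have h2 := hact Γ _ h 𝒯 𝒦 v ℓ (CutFEM.surfaceMean 𝒦 v) hh hhr hch h𝒦.bijOn.injOn
    h𝒯.quasiUniform hsub ((hM 𝒦 hch).trans_lt ENNReal.coe_lt_top).ne hvc fun t ht => (hℓ t ht).2
  rw [← CutFEM.surfaceGradNormSq_eq fun s hs => (hℓ' s hs).1] at h1
  rw [← CutFEM.activeGradNormSq_eq fun t ht => (hℓ t ht).1] at h2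
  set S := CutFEM.surfaceGradNormSq 𝒦 v with hS
  set G := CutFEM.activeGradNormSq 𝒯 𝒦.carrier v with hG
  have hG0 : 0 ≤ G :=
    Finset.sum_nonneg fun t _ => MeasureTheory.integral_nonneg fun x => by positivity
  have hS0 : 0 ≤ S :=
    Finset.sum_nonneg fun t _ => MeasureTheory.integral_nonneg fun x => by positivity
  have e1 : h ^ (-(c : ℤ)) * h ^ c = 1 := by
    rw [zpow_neg, zpow_natCast, inv_mul_cancel₀ (by positivity)]
  have e2 : h ^ (-(c : ℤ)) * h ^ 2 = h ^ (2 - (c : ℤ)) := by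
    rw [sub_eq_neg_add, zpow_add₀ hh.ne']
    norm_cast
  calc _ ≤ h ^ (-(c : ℤ)) * (C₂ * (h ^ c * (C₁ * S) + h ^ 2 * G)) := by
        gcongr
        exact h2.trans (by gcongr)
    _ = C₂ * ((h ^ (-(c : ℤ)) * h ^ c) * (C₁ * S) + (h ^ (-(c : ℤ)) * h ^ 2) * G) := by ring
    _ = C₂ * (C₁ * S + h ^ (2 - (c : ℤ)) * G) := by rw [e1, e2, one_mul]
    _ ≤ C₂ * ((C₁ + 1) * S + (C₁ + 1) * (h ^ (2 - (c : ℤ)) * G)) := by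
        have : 0 ≤ h ^ (2 - (c : ℤ)) * G := by positivity
        refine mul_le_mul_of_nonneg_left (add_le_add ?_ ?_) hC₂.le <;> nlinarith
    _ = _ := by ring
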